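/- A curve is an integral separated scheme of finite type over $\mathbb{C}$ of dimension one. The semigroup of a $\mathbb{C}$-subalgebra $R\subseteq\mathbb{C}[[t]]$ is $\Gamma_R=\{\operatorname{ord} f : f\in R\setminus\{0\}\}$. Let $\Gamma\subsetneq\mathbb{N}$ be a numerical semigroup, i.e. a submonoid of $(\mathbb{N},+)$ with finite non-empty complement, and let $\mathcal{R}_\Gamma$ be the set of $\mathbb{C}$-subalgebras $R\subseteq\mathbb{C}[[t]]$ that are complete (for the $t$-adic topology) and satisfy $\Gamma_R=\Gamma$. Let $Y$ be a smooth curve over $\mathbb{C}$ and $q\in Y$ a closed point. Let $\mathcal{M}_{(Y,q),\Gamma}$ be the set of pairs $(X,\pi)$, where $X$ is a curve over $\mathbb{C}$ and $\pi:Y\to X$ is a $\mathbb{C}$-morphism such that, with $p=\pi(q)$ (a closed point), $\pi^{-1}(p)=\{q\}$ and (i) $\pi$ is the normalisation of $X$ (i.e. $\pi$ is integral and birational, and $Y$ is normal); (ii) $p$ is a singular point of $X$ with semigroup $\Gamma$: for an identification $\widehat{\mathcal{O}}_{Y,q}\cong\mathbb{C}[[t]]$ of $\mathbb{C}$-algebras,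 the image of $\widehat{\mathcal{O}}_{X,p}\to\widehat{\mathcal{O}}_{Y,q}\cong\mathbb{C}[[t]]$ has semigroup $\Gamma$ (this does not depend on the identification); (iii) $\pi$ restricts to an isomorphism $Y\setminus\{q\}\to X\setminus\{p\}$; modulo the relation $(X_1,\pi_1)\sim(X_2,\pi_2)$ if there is an isomorphism $\phi:X_1\to X_2$ over $\mathbb{C}$ with $\phi\circ\pi_1=\pi_2$. Then there is an isomorphism of $\mathbb{C}$-algebras $\widehat{\mathcal{O}}_{Y,q}\cong\mathbb{C}[[t]]$, and for every such isomorphism $\iota$ the following hold. (a) For every pair $(X,\pi)$ as above the map $\widehat{\mathcal{O}}_{X,p}\to\widehat{\mathcal{O}}_{Y,q}$ induced by $\pi$ is injective, and sending $(X,\pi)$ to the image of $\widehat{\mathcal{O}}_{X,p}$ in $\mathbb{C}[[t]]$ (via $\iota$) gives a well-defined bijection $\mathcal{M}_{(Y,q),\Gamma}\to\mathcal{R}_\Gamma$. (b) The inverse bijection is given by gluing: if $(X,\pi)$ represents the class corresponding to $R\in\mathcal{R}_\Gamma$, then for every affine open neighbourhood $V=\operatorname{Spec}A$ of $q$ in $Y$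 there is an affine open $W\subseteq X$ with $\pi^{-1}(W)=V$ such that $\pi$ identifies $\mathcal{O}_X(W)$ with the ring $B\subseteq A$ of those elements of $A$ whose image in $\widehat{\mathcal{O}}_{Y,q}\cong\mathbb{C}[[t]]$ lies in $R$. Thus $X$ is the gluing of $\operatorname{Spec}B$ and $Y\setminus\{q\}$ along $V\setminus\{q\}$. -/

import Mathlib

open CategoryTheory AlgebraicGeometry IsLocalRing TopologicalSpace
open scoped PowerSeries

namespace CurveGluing

/-! ### Complete subalgebras of `ℂ⟦X⟧` with a given semigroup -/

/-- The semigroup of a `ℂ`-subalgebra `R` of `ℂ⟦X⟧`: the set of orders of its nonzero elements. -/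
def orderSet (R : Subalgebra ℂ ℂ⟦X⟧) : Set ℕ :=
  {n | ∃ f ∈ R, f ≠ 0 ∧ f.order = (n : ℕ∞)}

/-- `R` is complete for the `X`-adic topology of `ℂ⟦X⟧`: every `X`-adic Cauchy sequence
of elements of `R` converges `X`-adically to an element of `R`. -/
def IsCompleteSubalgebra (R : Subalgebra ℂ ℂ⟦X⟧) : Prop :=
  ∀ u : ℕ → ℂ⟦X⟧, (∀ n, u n ∈ R) →
    (∀ N, ∃ M, ∀ m ≥ M, ∀ n ≥ M, (PowerSeries.X : ℂ⟦X⟧) ^ N ∣ u m - u n) →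
    ∃ f ∈ R, ∀ N, ∃ M, ∀ n ≥ M, (PowerSeries.X : ℂ⟦X⟧) ^ N ∣ u n - f

/-- The set of complete `ℂ`-subalgebras of `ℂ⟦X⟧` with semigroup `Γ`. -/
def CompleteSubalgebras (Γ : AddSubmonoid ℕ) : Type :=
  {R : Subalgebra ℂ ℂ⟦X⟧ // IsCompleteSubalgebra R ∧ orderSet R = (Γ : Set ℕ)}

/-! ### Curves over `ℂ` -/

/-- The scheme `Spec ℂ`. -/
noncomputable abbrev SpecC : Scheme.{0} := Spec (CommRingCat.of ℂ)

/-- A curve over `ℂ`: a one-dimensional variety, that is, an integral separated scheme of finite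
type over `ℂ`, of dimension one. -/
structure IsCurve {X : Scheme.{0}} (s : X ⟶ SpecC) : Prop where
  isIntegral : IsIntegral X
  isSeparated : IsSeparated s
  locallyOfFiniteType : LocallyOfFiniteType s
  quasiCompact : QuasiCompact s
  dim_eq_one : topologicalKrullDim X = 1

/-! ### Complete local rings -/

/-- The local ring of `X` at `x`. The structure morphism `s` is recorded
for the sake of the `ℂ`-algebra structure. -/
def LocalRingAt {X : Scheme.{0}} (_s : X ⟶ SpecC) (x : X) : Type := X.presheaf.stalk x

noncomputable instance {X : Scheme.{0}} (s : X ⟶ SpecC) (x : X) : CommRing (LocalRingAt s x) :=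
  inferInstanceAs (CommRing (X.presheaf.stalk x))

instance {X : Scheme.{0}} (s : X ⟶ SpecC) (x : X) : IsLocalRing (LocalRingAt s x) :=
  inferInstanceAs (IsLocalRing (X.presheaf.stalk x))

/-- The structure map `ℂ → 𝒪_{X,x}`. -/
noncomputable def structureMap {X : Scheme.{0}} (s : X ⟶ SpecC) (x : X) :
    ℂ →+* X.presheaf.stalk x :=
  ((Scheme.ΓSpecIso (CommRingCat.of ℂ)).inv ≫ s.appTop ≫
    X.presheaf.germ ⊤ x (Opens.mem_top x)).hom

noncomputable instance {X : Scheme.{0}} (s : X ⟶ SpecC) (x : X) : Algebra ℂ (LocalRingAt s x) :=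
  (structureMap s x).toAlgebra

/-- The complete local ring of `X` at `x`. -/
abbrev CompleteLocalRing {X : Scheme.{0}} (s : X ⟶ SpecC) (x : X) : Type :=
  AdicCompletion (maximalIdeal (LocalRingAt s x)) (LocalRingAt s x)

/-- The map of local rings induced by a morphism over `ℂ`, as a `ℂ`-algebra homomorphism. -/
noncomputable def localRingMap {X Y : Scheme.{0}} {sX : X ⟶ SpecC} {sY : Y ⟶ SpecC}
    (π : Y ⟶ X) (hπ : π ≫ sX = sY) (q : Y) : LocalRingAt sX (π q) →ₐ[ℂ] LocalRingAt sY q where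
  __ := (π.stalkMap q).hom
  commutes' := by
    intro r
    subst hπ
    change π.stalkMap q (structureMap sX (π q) r) = structureMap (π ≫ sX) q r
    simp only [structureMap, CommRingCat.hom_comp, RingHom.comp_apply]
    erw [Scheme.Hom.germ_stalkMap_apply]
    simp
    rfl

instance {X Y : Scheme.{0}} {sX : X ⟶ SpecC} {sY : Y ⟶ SpecC}
    (π : Y ⟶ X) (hπ : π ≫ sX = sY) (q : Y) : IsLocalHom (localRingMap π hπ q) :=
  ⟨(inferInstance : IsLocalHom (π.stalkMap q).hom).map_nonunit⟩

/-- The map induced on completions (at the maximal ideals) by a local homomorphism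
of local algebras. It is the limit of the maps `A ⧸ 𝔪_A ^ n → B ⧸ 𝔪_B ^ n`. -/
noncomputable def completionMap {k A B : Type*} [CommRing k] [CommRing A] [CommRing B]
    [IsLocalRing A] [IsLocalRing B] [Algebra k A] [Algebra k B] (f : A →ₐ[k] B) [IsLocalHom f] :
    AdicCompletion (maximalIdeal A) A →ₐ[k] AdicCompletion (maximalIdeal B) B :=
  have hle (n : ℕ) : maximalIdeal A ^ n ≤ (maximalIdeal B ^ n).comap f :=
    (Ideal.pow_right_mono (fun a ha ↦ Ideal.mem_comap.mpr ((mem_maximalIdeal _).mpr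
      fun h ↦ (mem_maximalIdeal a).mp ha (isUnit_of_map_unit f a h))) n).trans
      (Ideal.le_comap_pow _ n)
  AdicCompletion.liftAlgHom (maximalIdeal B)
    (fun n ↦ (Ideal.quotientMapₐ (maximalIdeal B ^ n) f (hle n)).comp
      ((AdicCompletion.evalₐ (maximalIdeal A) n).restrictScalars k))
    (by
      intro m n hmn
      ext x
      obtain ⟨a, rfl⟩ := AdicCompletion.mk_surjective (maximalIdeal A) A x
      simp only [AlgHom.comp_apply, AlgHom.restrictScalars_apply, AdicCompletion.evalₐ_mk,
        Ideal.quotient_map_mkₐ]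
      refine Ideal.Quotient.eq.mpr ?_
      rw [← map_sub]
      exact hle m (Ideal.Quotient.eq.mp (AdicCompletion.Ideal.mk_eq_mk _ hmn a)))

/-- The subalgebra of `ℂ⟦X⟧` obtained as the image of the complete local ring of `X` at `π q`
under the map to the complete local ring of `Y` at `q` induced by `π`, the latter being
identified with `ℂ⟦X⟧` by `ι`. -/
noncomputable def completeLocalSubalgebra {X Y : Scheme.{0}} {sX : X ⟶ SpecC} {sY : Y ⟶ SpecC}
    (π : Y ⟶ X) (hπ : π ≫ sX = sY) (q : Y) (ι : CompleteLocalRing sY q ≃ₐ[ℂ] ℂ⟦X⟧) :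
    Subalgebra ℂ ℂ⟦X⟧ :=
  (ι.toAlgHom.comp (completionMap (localRingMap π hπ q))).range

/-- The power series expansion at `q` of a function on an open neighbourhood `V` of `q`, where the
complete local ring of `Y` at `q` is identified with `ℂ⟦X⟧` by `ι`. -/
noncomputable def expansion {Y : Scheme.{0}} {sY : Y ⟶ SpecC} {q : Y}
    (ι : CompleteLocalRing sY q ≃ₐ[ℂ] ℂ⟦X⟧) (V : Y.Opens) (hq : q ∈ V) (a : Γ(Y, V)) : ℂ⟦X⟧ :=
  ι (algebraMap (LocalRingAt sY q) (CompleteLocalRing sY q) (Y.presheaf.germ V q hq a))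

/-! ### Partial normalisations that are isomorphisms away from one point -/

/-- `π : Y ⟶ X` is the normalisation of the integral scheme `X`: it is integral and birational
(an isomorphism over some nonempty open subset of `X`), and `Y` is normal. -/
structure IsNormalisation {X Y : Scheme.{0}} (π : Y ⟶ X) : Prop where
  isIntegralHom : IsIntegralHom π
  normal : ∀ y : Y, IsIntegrallyClosed (Y.presheaf.stalk y)
  birational : ∃ U : X.Opens, (U : Set X).Nonempty ∧ IsIso (π ∣_ U)

/-- A pair `(X, π)` for the pointed curve `(Y, q)` and the semigroup `Γ`: a curve `X` and a morphism
`π : Y ⟶ X` of curves over `ℂ`, the marked point of `X` being `p = π q`. -/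
structure GluedCurve {Y : Scheme.{0}} (sY : Y ⟶ SpecC) (q : Y) (Γ : AddSubmonoid ℕ) where
  X : Scheme.{0}
  s : X ⟶ SpecC
  isCurve : IsCurve s
  π : Y ⟶ X
  w : π ≫ s = sY
  isClosed_point : IsClosed {π q}
  preimage_point : π ⁻¹' {π q} = {q}
  isNormalisation : IsNormalisation π
  singular : ¬ IsRegularLocalRing (X.presheaf.stalk (π q))
  semigroup : ∃ ι : CompleteLocalRing sY q ≃ₐ[ℂ] ℂ⟦X⟧,
    orderSet (completeLocalSubalgebra π w q ι) = (Γ : Set ℕ)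
  isIso_away : IsIso (π ∣_ (⟨{π q}ᶜ, isClosed_point.isOpen_compl⟩ : X.Opens))

/-- Two pairs `(X₁, π₁)` and `(X₂, π₂)` are equivalent if there is an isomorphism of curves
`X₁ ≅ X₂` over `ℂ` that carries `π₁` to `π₂`. -/
instance gluedCurveSetoid {Y : Scheme.{0}} (sY : Y ⟶ SpecC) (q : Y) (Γ : AddSubmonoid ℕ) :
    Setoid (GluedCurve sY q Γ) where
  r G H := ∃ φ : G.X ≅ H.X, φ.hom ≫ H.s = G.s ∧ G.π ≫ φ.hom = H.π
  iseqv :=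
    { refl := fun _ ↦ ⟨Iso.refl _, by simp, by simp⟩
      symm := by
        rintro G H ⟨φ, h₁, h₂⟩
        exact ⟨φ.symm, by simp [← h₁], by simp [← h₂]⟩
      trans := by
        rintro G H K ⟨φ, h₁, h₂⟩ ⟨ψ, h₃, h₄⟩
        exact ⟨φ ≪≫ ψ, by simp [h₁, h₃], by simp [← h₄, ← h₂]⟩ }

/-- The space of pairs `(X, π)` up to isomorphism under `Y`. -/
def GluedCurves {Y : Scheme.{0}} (sY : Y ⟶ SpecC) (q : Y) (Γ : AddSubmonoid ℕ) : Type 1 :=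
  Quotient (gluedCurveSetoid sY q Γ)

/-- The pair `(X, π)` is obtained by gluing along `R ⊆ ℂ⟦X⟧`: for every affine open neighbourhood
`V = Spec A` of `q`, the curve `X` has an affine open `W` with `π⁻¹ W = V` such that `π` identifies
the ring of `W` with the ring of those elements of `A` whose expansion at `q` lies in `R`. Together
with the isomorphism `Y ∖ {q} ≅ X ∖ {p}` this says that `X` is the gluing of `Y ∖ {q}` and the
spectrum of that ring. -/
def GluedCurve.IsGluingAlong {Y : Scheme.{0}} {sY : Y ⟶ SpecC} {q : Y} {Γ : AddSubmonoid ℕ}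
    (G : GluedCurve sY q Γ) (ι : CompleteLocalRing sY q ≃ₐ[ℂ] ℂ⟦X⟧)
    (R : Subalgebra ℂ ℂ⟦X⟧) : Prop :=
  ∀ V : Y.Opens, IsAffineOpen V → q ∈ V →
    ∃ W : G.X.Opens, IsAffineOpen W ∧ G.π ⁻¹ᵁ W = V ∧
      ∃ hq : q ∈ G.π ⁻¹ᵁ W,
        Function.Injective (G.π.app W) ∧
        Set.range (G.π.app W) = {a : Γ(Y, G.π ⁻¹ᵁ W) | expansion ι (G.π ⁻¹ᵁ W) hq a ∈ R}

end CurveGluing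

namespace CurveGluing

/-! ### Orders and the adic filtration of a complete local ring -/

/-! Write O for the local ring of Y at q and 𝔪 for its maximal ideal. Since Y is a smooth curve, O
is a discrete valuation ring with residue field ℂ, so its completion is ℂ⟦X⟧. Both sides of the
bijection are governed by the subring S ⊆ O which is the local ring of X at p.

The key is a conductor on each side. If R is complete and almost every order occurs in R, successive
approximation gives X^M ℂ⟦X⟧ ⊆ R (`exists_conductor`). If π : Y → X is the normalisation, it is
finite and an isomorphism away from q, so over an affine open set the conductor is contained in no
prime other than that of q; by noetherianity it contains a power of that prime, and 𝔪^M ⊆ S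
(`exists_pointIdeal_pow_le_range`). Once 𝔪^M ⊆ S, the completion of S embeds in ℂ⟦X⟧, and its image
R satisfies R = S + X^M ℂ⟦X⟧ and S = O ∩ R (`mem_range_iff_exists_X_pow_dvd`,
`expand_mem_range_iff`). Thus S and R determine each other.

Injectivity: π is a homeomorphism with injective stalk maps, so X under Y is determined by the
ranges of these maps (`exists_iso_of_range_stalkMap_eq`). They are everything at y ≠ q, and S = O ∩
R at q.

Surjectivity: given R, put S = O ∩ R. On an affine neighbourhood Spec A of q let B be the functions
with germ in S. As B contains a power of the maximal ideal of q, Spec A → Spec B is a homeomorphism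
that is an isomorphism away from q and has local ring S at q; gluing Spec B to Y ∖ {q} gives X
(`exists_curve_of_subring`). Separatedness descends along the integral surjection π, finite type by
Artin–Tate. If S were regular it would be integrally closed with the fraction field of O, forcing S
= O, R = ℂ⟦X⟧ and Γ = ℕ.

For the gluing description, the affine model of an arbitrary V and the restriction of π to V have
the same stalks, hence the same target. So the image of V is affine, and its functions are those of
V with germ in S. -/

theorem order_eq_iff_X_pow_dvd (f : ℂ⟦X⟧) (n : ℕ) :
    f.order = n ↔ (PowerSeries.X ^ n ∣ f) ∧ ¬ PowerSeries.X ^ (n + 1) ∣ f := by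
  rw [PowerSeries.order_eq_nat, PowerSeries.X_pow_dvd_iff, PowerSeries.X_pow_dvd_iff]
  constructor
  · rintro ⟨h₁, h₂⟩
    exact ⟨h₂, fun h ↦ h₁ (h n n.lt_succ_self)⟩
  · rintro ⟨h₁, h₂⟩
    refine ⟨fun h ↦ h₂ fun m hm ↦ ?_, h₁⟩
    rcases Nat.lt_succ_iff_lt_or_eq.mp hm with hm | rfl
    exacts [h₁ m hm, h]

/-- An automorphism preserves the maximal ideal (X) and its powers, so no continuity assumption is
needed. This makes the semigroup independent of the identification with ℂ⟦X⟧. -/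
theorem X_pow_dvd_algEquiv (σ : ℂ⟦X⟧ ≃ₐ[ℂ] ℂ⟦X⟧) (n : ℕ) (f : ℂ⟦X⟧) :
    PowerSeries.X ^ n ∣ σ f ↔ PowerSeries.X ^ n ∣ f := by
  have h : (maximalIdeal ℂ⟦X⟧).map (σ : ℂ⟦X⟧ ≃+* ℂ⟦X⟧) = maximalIdeal ℂ⟦X⟧ :=
    map_ringEquiv_maximalIdeal _
  rw [← Ideal.mem_span_singleton, ← Ideal.mem_span_singleton, ← Ideal.span_singleton_pow,
    ← PowerSeries.maximalIdeal_eq_span_X]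
  conv_lhs => rw [← h, ← Ideal.map_pow]
  rw [Ideal.mem_map_of_equiv]
  exact ⟨fun ⟨x, hx, hx'⟩ ↦ (σ.injective hx') ▸ hx, fun hf ↦ ⟨f, hf, rfl⟩⟩

theorem orderSet_map_algEquiv (σ : ℂ⟦X⟧ ≃ₐ[ℂ] ℂ⟦X⟧) (R : Subalgebra ℂ ℂ⟦X⟧) :
    orderSet (R.map σ.toAlgHom) = orderSet R := by
  have key (f : ℂ⟦X⟧) (n : ℕ) : (σ f).order = n ↔ f.order = n := by
    simp_rw [order_eq_iff_X_pow_dvd, X_pow_dvd_algEquiv]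
  ext n
  constructor
  · rintro ⟨_, ⟨f, hf, rfl⟩, h₁, h₂⟩
    exact ⟨f, hf, fun h ↦ h₁ (by simp [h]), (key f n).mp h₂⟩
  · rintro ⟨f, hf, h₁, h₂⟩
    exact ⟨σ f, ⟨f, hf, rfl⟩, by simpa using h₁, (key f n).mpr h₂⟩

/-! ### Expansion of elements of a local ring with completion ℂ⟦X⟧ -/

section LocalRing

variable {O : Type*} [CommRing O] [IsLocalRing O] [Algebra ℂ O]

/-- The expansion of an element of a local ring whose completion is identified with `ℂ⟦X⟧`. -/
noncomputable def expand (ι : AdicCompletion (maximalIdeal O) O ≃ₐ[ℂ] ℂ⟦X⟧) : O →ₐ[ℂ] ℂ⟦X⟧ :=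
  ι.toAlgHom.comp (IsScalarTower.toAlgHom ℂ O (AdicCompletion (maximalIdeal O) O))

theorem expand_apply (ι : AdicCompletion (maximalIdeal O) O ≃ₐ[ℂ] ℂ⟦X⟧) (a : O) :
    expand ι a = ι (algebraMap O _ a) := rfl

theorem evalₐ_algebraMap {A : Type*} [CommRing A] (I : Ideal A) (n : ℕ) (a : A) :
    AdicCompletion.evalₐ I n (algebraMap A (AdicCompletion I A) a) = Ideal.Quotient.mk _ a :=
  (AdicCompletion.evalₐ I n).commutes a

variable [IsNoetherianRing O] (ι : AdicCompletion (maximalIdeal O) O ≃ₐ[ℂ] ℂ⟦X⟧)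

omit [Algebra ℂ O] in
-- The maximal ideal of O is finitely generated, so the kernel of the projection to level n is
-- generated by its n-th power. This identifies the filtration of the inverse limit with an
-- intrinsic one, which any ring isomorphism preserves.
theorem evalₐ_eq_zero_iff (n : ℕ) (x : AdicCompletion (maximalIdeal O) O) :
    AdicCompletion.evalₐ (maximalIdeal O) n x = 0 ↔
      x ∈ maximalIdeal (AdicCompletion (maximalIdeal O) O) ^ n := by
  have h := AdicCompletion.pow_smul_top_eq_ker_eval (I := maximalIdeal O) (M := O) (n := n)
    (IsNoetherian.noetherian _)
  rw [Ideal.smul_top_eq_map, Ideal.map_pow, ← AdicCompletion.maximalIdeal_eq_map] at h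
  have h' := congr(x ∈ $h)
  rw [Submodule.restrictScalars_mem, LinearMap.mem_ker] at h'
  -- `eval` takes values in the quotient by 𝔪^n • ⊤ and `evalₐ` in the quotient by 𝔪^n; the rest
  -- identifies the two.
  rw [h', ← AdicCompletion.factor_eval_eq_evalₐ _ x (by simp)]
  refine ⟨fun h ↦ ?_, fun h ↦ by simp [h]⟩
  obtain ⟨a, ha⟩ := Ideal.Quotient.mk_surjective (AdicCompletion.eval (maximalIdeal O) O n x)
  rw [← ha] at h ⊢
  change Ideal.Quotient.mk (maximalIdeal O ^ n) a = 0 at h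
  rw [Ideal.Quotient.eq_zero_iff_mem] at h
  rw [Ideal.Quotient.eq_zero_iff_mem]
  simpa using h

theorem X_pow_dvd_iff_evalₐ (n : ℕ) (x : AdicCompletion (maximalIdeal O) O) :
    PowerSeries.X ^ n ∣ ι x ↔ AdicCompletion.evalₐ (maximalIdeal O) n x = 0 := by
  have h : (maximalIdeal (AdicCompletion (maximalIdeal O) O)).map
      (ι : AdicCompletion (maximalIdeal O) O ≃+* ℂ⟦X⟧) = maximalIdeal ℂ⟦X⟧ :=
    map_ringEquiv_maximalIdeal _
  rw [evalₐ_eq_zero_iff, ← Ideal.mem_span_singleton, ← Ideal.span_singleton_pow,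
    ← PowerSeries.maximalIdeal_eq_span_X, ← h, ← Ideal.map_pow, Ideal.mem_map_of_equiv]
  exact ⟨fun ⟨y, hy, hy'⟩ ↦ (ι.injective hy') ▸ hy, fun hf ↦ ⟨x, hf, rfl⟩⟩

theorem X_pow_dvd_expand_iff (n : ℕ) (a : O) :
    PowerSeries.X ^ n ∣ expand ι a ↔ a ∈ maximalIdeal O ^ n := by
  rw [expand_apply, X_pow_dvd_iff_evalₐ, evalₐ_algebraMap, Ideal.Quotient.eq_zero_iff_mem]

theorem exists_X_pow_dvd_sub_expand (n : ℕ) (f : ℂ⟦X⟧) :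
    ∃ a : O, PowerSeries.X ^ n ∣ f - expand ι a := by
  obtain ⟨a, ha⟩ := Ideal.Quotient.mk_surjective
    (AdicCompletion.evalₐ (maximalIdeal O) n (ι.symm f))
  refine ⟨a, ?_⟩
  rw [expand_apply, ← ι.apply_symm_apply f, ← map_sub, X_pow_dvd_iff_evalₐ]
  simp [ha]

end LocalRing

theorem eq_of_forall_X_pow_dvd_sub {f g : ℂ⟦X⟧} (h : ∀ n, PowerSeries.X ^ n ∣ f - g) : f = g := by
  ext n
  have := PowerSeries.X_pow_dvd_iff.mp (h (n + 1)) n n.lt_succ_self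
  rwa [map_sub, sub_eq_zero] at this

/-! ### Local subalgebras containing a power of the maximal ideal -/

theorem exists_limit_of_cauchy (u : ℕ → ℂ⟦X⟧)
    (hu : ∀ N, ∃ M, ∀ m ≥ M, ∀ n ≥ M, (PowerSeries.X : ℂ⟦X⟧) ^ N ∣ u m - u n) :
    ∃ f, ∀ N, ∃ M, ∀ n ≥ M, (PowerSeries.X : ℂ⟦X⟧) ^ N ∣ u n - f := by
  choose M hM using hu
  refine ⟨PowerSeries.mk fun n ↦ PowerSeries.coeff n (u (M (n + 1))), fun N ↦ ⟨M N, fun n hn ↦ ?_⟩⟩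
  rw [PowerSeries.X_pow_dvd_iff]
  intro m hm
  rw [map_sub, PowerSeries.coeff_mk, sub_eq_zero]
  let k := max (M N) (M (m + 1))
  have h₁ := PowerSeries.X_pow_dvd_iff.mp (hM N n hn k (le_max_left _ _)) m hm
  have h₂ := PowerSeries.X_pow_dvd_iff.mp (hM (m + 1) (M (m + 1)) le_rfl k (le_max_right _ _)) m
    m.lt_succ_self
  rw [map_sub, sub_eq_zero] at h₁ h₂
  rw [h₁, h₂]

/-- Such an R is an open subgroup of ℂ⟦X⟧, hence closed: the limit differs from a late term by a
multiple of X^M. -/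
theorem isCompleteSubalgebra_of_X_pow_dvd {R : Subalgebra ℂ ℂ⟦X⟧} {M : ℕ}
    (hR : ∀ g, PowerSeries.X ^ M ∣ g → g ∈ R) : IsCompleteSubalgebra R := by
  intro u hu hc
  obtain ⟨f, hf⟩ := exists_limit_of_cauchy u hc
  refine ⟨f, ?_, hf⟩
  obtain ⟨K, hK⟩ := hf M
  simpa using R.sub_mem (hu K) (hR _ (hK K le_rfl))

/-- From some M on every order occurs in R. A multiple g of X^M can then be approximated by
cancelling one leading coefficient after another with elements of R, and completeness puts the
limit, which is g, in R. -/
theorem exists_conductor {R : Subalgebra ℂ ℂ⟦X⟧} (hR : IsCompleteSubalgebra R)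
    (hfin : (orderSet R)ᶜ.Finite) : ∃ M, ∀ g, PowerSeries.X ^ M ∣ g → g ∈ R := by
  obtain ⟨M, hM⟩ : ∃ M, ∀ n ≥ M, n ∈ orderSet R := by
    obtain ⟨M, hM⟩ := hfin.bddAbove
    refine ⟨M + 1, fun n hn ↦ ?_⟩
    by_contra h
    have := hM h
    omega
  have step (n : ℕ) (g : ℂ⟦X⟧) (hn : M ≤ n) (hg : PowerSeries.X ^ n ∣ g) :
      ∃ h ∈ R, PowerSeries.X ^ n ∣ h ∧ PowerSeries.X ^ (n + 1) ∣ g - h := by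
    obtain ⟨h, hh, -, ho⟩ := hM n hn
    rw [PowerSeries.order_eq_nat] at ho
    rw [PowerSeries.X_pow_dvd_iff] at hg
    refine ⟨(PowerSeries.coeff n g / PowerSeries.coeff n h) • h, R.smul_mem hh _, ?_, ?_⟩
    · rw [PowerSeries.X_pow_dvd_iff]
      intro m hm
      simp [ho.2 m hm]
    · rw [PowerSeries.X_pow_dvd_iff]
      intro m hm
      rcases Nat.lt_succ_iff_lt_or_eq.mp hm with hm | rfl
      · simp [ho.2 m hm, hg m hm]
      · simp [ho.1]
  choose! s hsR hsn hs using step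
  refine ⟨M, fun g hg ↦ ?_⟩
  -- Partial sums of the corrections: u k lies in R and agrees with g modulo X^(M + k).
  let u : ℕ → ℂ⟦X⟧ := fun k ↦ k.rec 0 fun k v ↦ v + s (M + k) (g - v)
  have hu0 : u 0 = 0 := rfl
  have hus (k : ℕ) : u (k + 1) = u k + s (M + k) (g - u k) := rfl
  have hgu (k : ℕ) : PowerSeries.X ^ (M + k) ∣ g - u k := by
    induction k with
    | zero => simpa [hu0] using hg
    | succ k ih =>
      rw [hus, ← sub_sub]
      exact hs _ _ (Nat.le_add_right M k) ih
  have huR (k : ℕ) : u k ∈ R := by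
    induction k with
    | zero => simp [hu0]
    | succ k ih => exact R.add_mem ih (hsR _ _ (Nat.le_add_right M k) (hgu k))
  obtain ⟨f, hf, hfu⟩ := hR u huR fun N ↦ ⟨N, fun m hm n hn ↦ by
    have h₁ := (pow_dvd_pow PowerSeries.X (hm.le.trans (Nat.le_add_left m M))).trans (hgu m)
    have h₂ := (pow_dvd_pow PowerSeries.X (hn.le.trans (Nat.le_add_left n M))).trans (hgu n)
    simpa using dvd_sub h₂ h₁⟩
  convert! hf
  refine eq_of_forall_X_pow_dvd_sub fun N ↦ ?_
  obtain ⟨K, hK⟩ := hfu N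
  have h₁ := hK (max K N) (le_max_left _ _)
  have h₂ := (pow_dvd_pow PowerSeries.X
    ((le_max_right K N).trans (Nat.le_add_left _ M))).trans (hgu (max K N))
  simpa using dvd_add h₂ h₁

/-- With c the constant term of v, h = 1 - c u has no constant term and v is c times the geometric
series in h. Its first M terms lie in R, and the remainder v h^M is a multiple of X^M. -/
theorem inv_mem_of_X_pow_dvd {R : Subalgebra ℂ ℂ⟦X⟧} {M : ℕ}
    (hR : ∀ g, PowerSeries.X ^ M ∣ g → g ∈ R) {u v : ℂ⟦X⟧} (hu : u ∈ R) (huv : u * v = 1) :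
    v ∈ R := by
  let c : ℂ := PowerSeries.constantCoeff v
  let h : ℂ⟦X⟧ := 1 - c • u
  have hh : h ∈ R := R.sub_mem R.one_mem (R.smul_mem hu c)
  have hX : PowerSeries.X ∣ h := by
    rw [PowerSeries.X_dvd_iff]
    have := congr(PowerSeries.constantCoeff $huv)
    simp only [map_mul, map_one] at this
    simp only [h, c, map_sub, map_one]
    rw [PowerSeries.smul_eq_C_mul, map_mul, PowerSeries.constantCoeff_C, mul_comm, this, sub_self]
  have hgeom : c • (∑ i ∈ Finset.range M, h ^ i) = v - v * h ^ M := by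
    have h₁ : (1 - h) * ∑ i ∈ Finset.range M, h ^ i = 1 - h ^ M := by
      rw [mul_neg_geom_sum]
    have h₂ : (1 - h) = c • u := by simp [h]
    rw [h₂] at h₁
    calc c • (∑ i ∈ Finset.range M, h ^ i)
        = (u * v) * (c • ∑ i ∈ Finset.range M, h ^ i) := by rw [huv, one_mul]
      _ = v * (c • u * ∑ i ∈ Finset.range M, h ^ i) := by
        rw [PowerSeries.smul_eq_C_mul, PowerSeries.smul_eq_C_mul]; ring
      _ = v - v * h ^ M := by rw [h₁]; ring
  have h₃ : v * h ^ M ∈ R := hR _ ((pow_dvd_pow_of_dvd hX M).mul_left v)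
  have h₄ : c • (∑ i ∈ Finset.range M, h ^ i) ∈ R :=
    R.smul_mem (R.sum_mem fun i _ ↦ R.pow_mem hh i) c
  rw [hgeom] at h₄
  simpa using R.add_mem h₄ h₃

/-! ### Completion of a local ring mapping onto a power of the maximal ideal -/

section CompletionMap

variable {S O : Type*} [CommRing S] [CommRing O] [IsLocalRing S] [IsLocalRing O]
  [Algebra ℂ S] [Algebra ℂ O] (f : S →ₐ[ℂ] O) [IsLocalHom f]

theorem evalₐ_completionMap (n : ℕ) (x : AdicCompletion (maximalIdeal S) S) (s : S)
    (hs : AdicCompletion.evalₐ (maximalIdeal S) n x = Ideal.Quotient.mk _ s) :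
    AdicCompletion.evalₐ (maximalIdeal O) n (completionMap f x) = Ideal.Quotient.mk _ (f s) := by
  rw [completionMap, AdicCompletion.evalₐ_liftAlgHom]
  · simp [hs]
  · intro m n hmn
    ext x
    obtain ⟨a, rfl⟩ := AdicCompletion.mk_surjective (maximalIdeal S) S x
    simp only [AlgHom.comp_apply, AlgHom.restrictScalars_apply, AdicCompletion.evalₐ_mk,
      Ideal.quotient_map_mkₐ]
    refine Ideal.Quotient.eq.mpr ?_
    rw [← map_sub]
    exact (Ideal.pow_right_mono (fun a ha ↦ Ideal.mem_comap.mpr ((mem_maximalIdeal _).mpr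
      fun h ↦ (mem_maximalIdeal a).mp ha (isUnit_of_map_unit f a h))) m).trans
      (Ideal.le_comap_pow _ m) (Ideal.Quotient.eq.mp (AdicCompletion.Ideal.mk_eq_mk _ hmn a))

theorem completionMap_algebraMap (s : S) :
    completionMap f (algebraMap S _ s) = algebraMap O _ (f s) := by
  refine AdicCompletion.ext_evalₐ fun n ↦ ?_
  rw [evalₐ_completionMap f n _ s (evalₐ_algebraMap _ _ _), evalₐ_algebraMap]

variable {f} {M : ℕ}

omit [IsLocalHom f] in
-- This compares the two adic topologies. A preimage of an element of 𝔪_O^M is a non-unit because M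
-- > 0, and a product of n + 1 such preimages lies in 𝔪_S^(n + 1).
theorem exists_mem_pow_of_mem_pow (hM0 : 0 < M)
    (hM : ∀ a ∈ maximalIdeal O ^ M, a ∈ Set.range f) (n : ℕ) {a : O}
    (ha : a ∈ maximalIdeal O ^ (M * (n + 1))) : ∃ s ∈ maximalIdeal S ^ (n + 1), f s = a := by
  have base {a : O} (ha : a ∈ maximalIdeal O ^ M) : ∃ s ∈ maximalIdeal S, f s = a := by
    obtain ⟨s, rfl⟩ := hM a ha
    refine ⟨s, (mem_maximalIdeal s).mpr fun h ↦ ?_, rfl⟩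
    exact (mem_maximalIdeal _).mp (Ideal.pow_le_self hM0.ne' ha) (h.map f)
  induction n generalizing a with
  | zero => simpa using base (by simpa using ha)
  | succ n ih =>
    rw [mul_add, mul_one, pow_add] at ha
    induction ha using Submodule.mul_induction_on' with
    | mem_mul_mem a ha b hb =>
      obtain ⟨s, hs, rfl⟩ := ih ha
      obtain ⟨t, ht, rfl⟩ := base hb
      exact ⟨s * t, by rw [pow_succ]; exact Ideal.mul_mem_mul hs ht, map_mul f s t⟩
    | add a _ b _ ha hb =>
      obtain ⟨s, hs, rfl⟩ := ha
      obtain ⟨t, ht, rfl⟩ := hb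
      exact ⟨s + t, Ideal.add_mem _ hs ht, map_add f s t⟩

theorem completionMap_injective (hf : Function.Injective f) (hM0 : 0 < M)
    (hM : ∀ a ∈ maximalIdeal O ^ M, a ∈ Set.range f) :
    Function.Injective (completionMap f) := by
  rw [injective_iff_map_eq_zero]
  intro x hx
  refine AdicCompletion.ext_evalₐ fun n ↦ ?_
  obtain ⟨a, rfl⟩ := AdicCompletion.mk_surjective (maximalIdeal S) S x
  rw [map_zero, AdicCompletion.evalₐ_mk]
  -- Vanishing at level M (n + 1) over O is what forces vanishing at level n over S.
  have h := evalₐ_completionMap f (M * (n + 1)) _ _ (AdicCompletion.evalₐ_mk _ _ a)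
  rw [hx, map_zero, eq_comm, Ideal.Quotient.eq_zero_iff_mem] at h
  obtain ⟨s, hs, hsa⟩ := exists_mem_pow_of_mem_pow hM0 hM n h
  rw [hf hsa] at hs
  have hn : n ≤ M * (n + 1) := n.le_succ.trans (Nat.le_mul_of_pos_left _ hM0)
  rw [← AdicCompletion.Ideal.mk_eq_mk _ hn a, Ideal.Quotient.eq_zero_iff_mem]
  exact Ideal.pow_le_pow_right n.le_succ hs

variable [IsNoetherianRing O] (ι : AdicCompletion (maximalIdeal O) O ≃ₐ[ℂ] ℂ⟦X⟧)

omit [IsNoetherianRing O] in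
theorem expand_mem_range (s : S) :
    expand ι (f s) ∈ (ι.toAlgHom.comp (completionMap f)).range :=
  ⟨algebraMap S _ s, congr(ι $(completionMap_algebraMap f s))⟩

/-- Approximate g modulo X^(M (n + 1)) by elements of O. These lie in 𝔪_O^M, hence come from S, and
by `exists_mem_pow_of_mem_pow` their preimages form a Cauchy sequence in S, whose limit maps to g.
-/
theorem mem_range_of_X_pow_dvd (hf : Function.Injective f) (hM0 : 0 < M)
    (hM : ∀ a ∈ maximalIdeal O ^ M, a ∈ Set.range f) {g : ℂ⟦X⟧} (hg : PowerSeries.X ^ M ∣ g) :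
    g ∈ (ι.toAlgHom.comp (completionMap f)).range := by
  choose a ha using fun n ↦ exists_X_pow_dvd_sub_expand ι (M * (n + 1)) g
  have hle (n : ℕ) : M ≤ M * (n + 1) := Nat.le_mul_of_pos_right M n.succ_pos
  have haM (n : ℕ) : a n ∈ maximalIdeal O ^ M := by
    rw [← X_pow_dvd_expand_iff ι]
    simpa using dvd_sub hg ((pow_dvd_pow _ (hle n)).trans (ha n))
  choose s hs using fun n ↦ hM _ (haM n)
  have hcauchy (n : ℕ) : s (n + 1) - s n ∈ maximalIdeal S ^ (n + 1) := by
    have h : a (n + 1) - a n ∈ maximalIdeal O ^ (M * (n + 1)) := by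
      rw [← X_pow_dvd_expand_iff ι, map_sub]
      have h₁ := (pow_dvd_pow PowerSeries.X
        (Nat.mul_le_mul_left M (n + 1).le_succ)).trans (ha (n + 1))
      simpa using dvd_sub (ha n) h₁
    obtain ⟨t, ht, hta⟩ := exists_mem_pow_of_mem_pow hM0 hM n h
    rw [← hs, ← hs, ← map_sub] at hta
    rwa [← hf hta]
  let x : AdicCompletion.AdicCauchySequence (maximalIdeal S) S :=
    AdicCompletion.AdicCauchySequence.mk (maximalIdeal S) S s fun n ↦ by
      rw [SModEq.comm, SModEq.sub_mem]
      simpa using Ideal.pow_le_pow_right n.le_succ (hcauchy n)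
  refine ⟨AdicCompletion.mk _ _ x, eq_of_forall_X_pow_dvd_sub fun n ↦ ?_⟩
  have h₁ : PowerSeries.X ^ n ∣ ι (completionMap f (AdicCompletion.mk _ _ x)) -
      expand ι (a n) := by
    rw [expand_apply, ← map_sub, X_pow_dvd_iff_evalₐ, map_sub, evalₐ_algebraMap,
      evalₐ_completionMap f n _ _ (AdicCompletion.evalₐ_mk _ _ x), ← hs]
    exact sub_self _
  have h₂ := (pow_dvd_pow PowerSeries.X
    (n.le_succ.trans (Nat.le_mul_of_pos_left _ hM0))).trans (ha n)
  simpa using dvd_sub h₁ h₂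

/-- The completed image is S + X^M ℂ⟦X⟧: an element of the completion agrees with an element of S at
level M, and the rest is in the range by `mem_range_of_X_pow_dvd`. -/
theorem mem_range_iff_exists_X_pow_dvd (hf : Function.Injective f) (hM0 : 0 < M)
    (hM : ∀ a ∈ maximalIdeal O ^ M, a ∈ Set.range f) (g : ℂ⟦X⟧) :
    g ∈ (ι.toAlgHom.comp (completionMap f)).range ↔
      ∃ s, PowerSeries.X ^ M ∣ g - expand ι (f s) := by
  constructor
  · rintro ⟨x, rfl⟩
    obtain ⟨s, hs⟩ := Ideal.Quotient.mk_surjective (AdicCompletion.evalₐ (maximalIdeal S) M x)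
    refine ⟨s, ?_⟩
    change PowerSeries.X ^ M ∣ ι (completionMap f x) - _
    rw [expand_apply, ← map_sub, X_pow_dvd_iff_evalₐ, map_sub, evalₐ_algebraMap,
      evalₐ_completionMap f M _ _ hs.symm, sub_self]
  · rintro ⟨s, hs⟩
    simpa using Subalgebra.add_mem _ (mem_range_of_X_pow_dvd ι hf hM0 hM hs)
      (expand_mem_range (f := f) ι s)

/-- Completing loses nothing: by the previous description such an a differs from an element of S by
an element of 𝔪_O^M, which comes from S as well. -/
theorem expand_mem_range_iff (hf : Function.Injective f) (hM0 : 0 < M)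
    (hM : ∀ a ∈ maximalIdeal O ^ M, a ∈ Set.range f) (a : O) :
    expand ι a ∈ (ι.toAlgHom.comp (completionMap f)).range ↔ a ∈ Set.range f := by
  refine ⟨fun h ↦ ?_, fun ⟨s, hs⟩ ↦ hs ▸ expand_mem_range ι s⟩
  obtain ⟨s, hs⟩ := (mem_range_iff_exists_X_pow_dvd ι hf hM0 hM _).mp h
  rw [← map_sub, X_pow_dvd_expand_iff] at hs
  obtain ⟨t, ht⟩ := hM _ hs
  exact ⟨t + s, by rw [map_add, ht, sub_add_cancel]⟩

/-- The image of the completion of a local subring that contains a power of the maximal ideal is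
determined by the subring: it is the set of limits of expansions of its elements. -/
theorem mem_range_iff_forall_exists (hf : Function.Injective f) (hM0 : 0 < M)
    (hM : ∀ a ∈ maximalIdeal O ^ M, a ∈ Set.range f) (g : ℂ⟦X⟧) :
    g ∈ (ι.toAlgHom.comp (completionMap f)).range ↔
      ∀ n, ∃ a ∈ Set.range f, PowerSeries.X ^ n ∣ g - expand ι a := by
  constructor
  · intro hg n
    obtain ⟨s, hs⟩ := (mem_range_iff_exists_X_pow_dvd ι hf (hM0.trans_le (Nat.le_add_left M n))
      (fun a ha ↦ hM a (Ideal.pow_le_pow_right (Nat.le_add_left M n) ha)) g).mp hg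
    exact ⟨f s, ⟨s, rfl⟩, (pow_dvd_pow _ (Nat.le_add_right n M)).trans hs⟩
  · intro h
    obtain ⟨_, ⟨s, rfl⟩, hs⟩ := h M
    exact (mem_range_iff_exists_X_pow_dvd ι hf hM0 hM g).mpr ⟨s, hs⟩

end CompletionMap

/-! ### The completion of a discrete valuation ring with residue field `ℂ` -/

section Uniformizer

open Polynomial

variable {O : Type*} [CommRing O] [IsLocalRing O] [Algebra ℂ O] {τ : O}

theorem aeval_mem_pow_of_X_pow_dvd (hτ : maximalIdeal O = Ideal.span {τ}) {n : ℕ} {p : ℂ[X]}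
    (h : X ^ n ∣ p) : aeval τ p ∈ maximalIdeal O ^ n := by
  obtain ⟨r, rfl⟩ := h
  rw [map_mul, map_pow, aeval_X, hτ, Ideal.span_singleton_pow, Ideal.mem_span_singleton]
  exact dvd_mul_right _ _

/-- After cancelling τ^n, the remaining factor has its value at τ in 𝔪, so its constant coefficient
lies in 𝔪 too; a nonzero constant would be a unit. -/
theorem X_pow_dvd_of_aeval_mem_pow [IsDomain O] (hτ : maximalIdeal O = Ideal.span {τ})
    (hτ0 : τ ≠ 0) {n : ℕ}
    {p : ℂ[X]} (h : aeval τ p ∈ maximalIdeal O ^ n) : X ^ n ∣ p := by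
  induction n generalizing p with
  | zero => simp
  | succ n ih =>
    obtain ⟨r, rfl⟩ := ih (Ideal.pow_le_pow_right n.le_succ h)
    rw [pow_succ]
    refine mul_dvd_mul_left _ ?_
    rw [map_mul, map_pow, aeval_X, hτ, Ideal.span_singleton_pow, Ideal.mem_span_singleton,
      pow_succ, mul_dvd_mul_iff_left (pow_ne_zero n hτ0)] at h
    rw [X_dvd_iff]
    by_contra hc
    have h₁ : τ ∣ aeval τ r - algebraMap ℂ O (r.coeff 0) := by
      have := map_dvd (aeval τ) (X_dvd_sub_C (p := r))
      rwa [map_sub, aeval_X, aeval_C] at this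
    have h₂ : τ ∣ algebraMap ℂ O (r.coeff 0) := by simpa using dvd_sub h h₁
    rw [← Ideal.mem_span_singleton, ← hτ, mem_maximalIdeal] at h₂
    exact h₂ ((isUnit_iff_ne_zero.mpr hc).map _)

/-- The τ-adic expansion, one digit at a time; the digits can be constants because the residue field
is ℂ. -/
theorem exists_sub_aeval_mem_pow (hτ : maximalIdeal O = Ideal.span {τ})
    (hres : ∀ a : O, ∃ c : ℂ, a - algebraMap ℂ O c ∈ maximalIdeal O) (n : ℕ) (a : O) :
    ∃ p : ℂ[X], a - aeval τ p ∈ maximalIdeal O ^ n := by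
  induction n with
  | zero => exact ⟨0, by simp⟩
  | succ n ih =>
    obtain ⟨p, hp⟩ := ih
    rw [hτ, Ideal.span_singleton_pow, Ideal.mem_span_singleton] at hp
    obtain ⟨b, hb⟩ := hp
    obtain ⟨c, hc⟩ := hres b
    refine ⟨p + X ^ n * C c, ?_⟩
    rw [map_add, map_mul, map_pow, aeval_X, aeval_C, ← sub_sub, hb, ← mul_sub, pow_succ]
    refine Ideal.mul_mem_mul ?_ hc
    rw [hτ]
    exact Ideal.pow_mem_pow (Ideal.mem_span_singleton_self τ) n

/-- This reduces the homomorphism axioms and the compatibilities of `truncEval` to congruences of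
power series modulo X^n. -/
theorem aeval_trunc_sub_mem_pow (hτ : maximalIdeal O = Ideal.span {τ}) {n : ℕ} {p : ℂ[X]}
    {f : ℂ⟦X⟧} (h : PowerSeries.X ^ n ∣ (p : ℂ⟦X⟧) - f) :
    aeval τ (PowerSeries.trunc n f) - aeval τ p ∈ maximalIdeal O ^ n := by
  rw [← map_sub]
  refine aeval_mem_pow_of_X_pow_dvd hτ ?_
  rw [X_pow_dvd_iff]
  intro d hd
  have := PowerSeries.X_pow_dvd_iff.mp h d hd
  rw [map_sub, Polynomial.coeff_coe] at this
  rw [Polynomial.coeff_sub, PowerSeries.coeff_trunc, if_pos hd, ← neg_sub, this, neg_zero]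

theorem X_pow_dvd_trunc_sub (n : ℕ) (f : ℂ⟦X⟧) :
    PowerSeries.X ^ n ∣ (PowerSeries.trunc n f : ℂ⟦X⟧) - f := by
  rw [PowerSeries.X_pow_dvd_iff]
  intro d hd
  rw [map_sub, Polynomial.coeff_coe, PowerSeries.coeff_trunc, if_pos hd, sub_self]

/-- Evaluation of power series at a uniformizer, modulo a power of the maximal ideal. -/
noncomputable def truncEval (hτ : maximalIdeal O = Ideal.span {τ}) (n : ℕ) :
    ℂ⟦X⟧ →ₐ[ℂ] O ⧸ maximalIdeal O ^ n where
  toFun f := Ideal.Quotient.mk _ (aeval τ (PowerSeries.trunc n f))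
  map_one' := by
    rw [← map_one (Ideal.Quotient.mk (maximalIdeal O ^ n)), ← map_one (aeval (R := ℂ) τ)]
    exact Ideal.Quotient.eq.mpr (aeval_trunc_sub_mem_pow hτ (by simp))
  map_mul' f g := by
    rw [← map_mul, ← map_mul]
    refine Ideal.Quotient.eq.mpr (aeval_trunc_sub_mem_pow hτ ?_)
    have h₁ := (X_pow_dvd_trunc_sub n f).mul_right (PowerSeries.trunc n g : ℂ⟦X⟧)
    have h₂ := (X_pow_dvd_trunc_sub n g).mul_left f
    convert! dvd_add h₁ h₂ using 1
    rw [Polynomial.coe_mul]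
    ring
  map_zero' := by simp
  map_add' f g := by simp
  commutes' c := by
    change _ = Ideal.Quotient.mk _ (algebraMap ℂ O c)
    rw [← aeval_C (R := ℂ) τ c]
    refine Ideal.Quotient.eq.mpr (aeval_trunc_sub_mem_pow hτ ?_)
    simp

theorem truncEval_apply (hτ : maximalIdeal O = Ideal.span {τ}) (n : ℕ) (f : ℂ⟦X⟧) :
    truncEval hτ n f = Ideal.Quotient.mk _ (aeval τ (PowerSeries.trunc n f)) := rfl

theorem factor_comp_truncEval (hτ : maximalIdeal O = Ideal.span {τ}) {m n : ℕ} (hmn : m ≤ n) :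
    (Ideal.Quotient.factorₐ ℂ (Ideal.pow_le_pow_right hmn)).comp (truncEval hτ n) =
      truncEval hτ m := by
  ext f
  rw [AlgHom.comp_apply, truncEval_apply, truncEval_apply]
  refine Eq.symm (Ideal.Quotient.eq.mpr (aeval_trunc_sub_mem_pow hτ ?_))
  exact (pow_dvd_pow _ hmn).trans (X_pow_dvd_trunc_sub n f)

/-- The completion of a discrete valuation ring with residue field `ℂ` is `ℂ⟦X⟧`. -/
theorem nonempty_completion_algEquiv [IsDomain O] (hτ : maximalIdeal O = Ideal.span {τ})
    (hτ0 : τ ≠ 0)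
    (hres : ∀ a : O, ∃ c : ℂ, a - algebraMap ℂ O c ∈ maximalIdeal O) :
    Nonempty (AdicCompletion (maximalIdeal O) O ≃ₐ[ℂ] ℂ⟦X⟧) := by
  let φ : ℂ⟦X⟧ →ₐ[ℂ] AdicCompletion (maximalIdeal O) O :=
    AdicCompletion.liftAlgHom (maximalIdeal O) (truncEval hτ) (factor_comp_truncEval hτ)
  have hφ (n : ℕ) (f : ℂ⟦X⟧) : AdicCompletion.evalₐ (maximalIdeal O) n (φ f) =
      Ideal.Quotient.mk _ (aeval τ (PowerSeries.trunc n f)) :=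
    AdicCompletion.evalₐ_liftAlgHom (maximalIdeal O) (truncEval hτ) (factor_comp_truncEval hτ) n f
  refine ⟨(AlgEquiv.ofBijective φ ⟨?_, fun x ↦ ?_⟩).symm⟩
  · rw [injective_iff_map_eq_zero]
    intro f hf
    ext n
    have h := hφ (n + 1) f
    rw [hf, map_zero, eq_comm, Ideal.Quotient.eq_zero_iff_mem] at h
    have := X_pow_dvd_iff.mp (X_pow_dvd_of_aeval_mem_pow hτ hτ0 h) n n.lt_succ_self
    rwa [PowerSeries.coeff_trunc, if_pos n.lt_succ_self] at this
  · obtain ⟨a, rfl⟩ := AdicCompletion.mk_surjective (maximalIdeal O) O x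
    choose p hp using fun n ↦ exists_sub_aeval_mem_pow hτ hres n (a n)
    have hpp {m n : ℕ} (hmn : m ≤ n) : X ^ m ∣ p n - p m := by
      refine X_pow_dvd_of_aeval_mem_pow hτ hτ0 ?_
      have h₁ : a n - a m ∈ maximalIdeal O ^ m :=
        Ideal.Quotient.eq.mp (AdicCompletion.Ideal.mk_eq_mk _ hmn a)
      have h₂ := Ideal.pow_le_pow_right hmn (hp n)
      convert! Ideal.add_mem _ (Ideal.sub_mem _ h₁ h₂) (hp m) using 1
      rw [map_sub]
      ring
    -- The n-th coefficient of the polynomials p m is constant from m = n + 1 on, by `hpp`.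
    refine ⟨PowerSeries.mk fun n ↦ (p (n + 1)).coeff n, AdicCompletion.ext_evalₐ fun n ↦ ?_⟩
    rw [hφ, AdicCompletion.evalₐ_mk]
    refine Ideal.Quotient.eq.mpr ?_
    rw [← neg_sub, neg_mem_iff]
    have h₁ : aeval τ (PowerSeries.trunc n (PowerSeries.mk fun n ↦ (p (n + 1)).coeff n)) -
        aeval τ (p n) ∈ maximalIdeal O ^ n := by
      refine aeval_trunc_sub_mem_pow hτ ?_
      rw [PowerSeries.X_pow_dvd_iff]
      intro d hd
      have := X_pow_dvd_iff.mp (hpp (Nat.succ_le_of_lt hd)) d d.lt_succ_self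
      simpa using this
    convert! Ideal.sub_mem _ (hp n) h₁ using 1
    ring

end Uniformizer

/-! ### Stalks of smooth curves -/

open scoped nonZeroDivisors TensorProduct in
/-- An étale algebra over an integrally closed domain is integrally closed, if it is a domain. -/
theorem isIntegrallyClosed_of_etale (P S : Type*) [CommRing P] [CommRing S] [Algebra P S]
    [IsDomain P] [IsIntegrallyClosed P] [IsDomain S] [Algebra.Etale P S] :
    IsIntegrallyClosed S := by
  let K := FractionRing P
  have hinj : Function.Injective (algebraMap P S) := FaithfulSMul.algebraMap_injective P S
  have hloc : IsLocalization (Algebra.algebraMapSubmonoid S P⁰) (S ⊗[P] K) :=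
    IsLocalization.tensor K P⁰
  have hle : Algebra.algebraMapSubmonoid S P⁰ ≤ S⁰ := by
    rintro _ ⟨p, hp, rfl⟩
    exact mem_nonZeroDivisors_of_ne_zero
      ((map_ne_zero_iff _ hinj).mpr (nonZeroDivisors.ne_zero hp))
  have : IsDomain (S ⊗[P] K) := IsLocalization.isDomain_of_le_nonZeroDivisors _ hle
  have e := Algebra.TensorProduct.comm P S K
  have : IsDomain (K ⊗[P] S) := e.symm.toMulEquiv.isDomain _
  -- An étale algebra over a field is finite; being a domain, it is a field, and hence the fraction
  -- field of S.
  have : Module.Finite K (K ⊗[P] S) := Algebra.FormallyUnramified.finite_of_free K (K ⊗[P] S)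
  have hfield : IsField (S ⊗[P] K) := e.toMulEquiv.isField
    (isField_of_isIntegral_of_isField' (Field.toIsField K))
  let := hfield.toField
  have : FaithfulSMul S (S ⊗[P] K) := (faithfulSMul_iff_algebraMap_injective _ _).mpr
    (IsLocalization.injective _ hle)
  have : IsFractionRing S (S ⊗[P] K) := IsFractionRing.of_field _ _ fun z ↦ by
    obtain ⟨⟨x, y⟩, h⟩ := IsLocalization.surj (Algebra.algebraMapSubmonoid S P⁰) z
    refine ⟨x, y, ?_⟩
    rw [eq_div_iff, h]
    exact ((IsLocalization.map_units _ y)).ne_zero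
  rw [isIntegrallyClosed_iff (S ⊗[P] K)]
  intro x hx
  -- Integral closure commutes with smooth base change: the integral closure of S in its fraction
  -- field is S tensored with that of P in K, which is P.
  obtain ⟨t, ht⟩ := (TensorProduct.toIntegralClosure_bijective_of_smooth (R := P) (S := S)
    (B := K)).2 ⟨x, hx⟩
  rw [← show (TensorProduct.toIntegralClosure P S K t).1 = x from congr($ht.1)]
  clear ht hx
  induction t with
  | zero => exact ⟨0, by simp⟩
  | add t u ht hu =>
    obtain ⟨y, hy⟩ := ht
    obtain ⟨z, hz⟩ := hu
    exact ⟨y + z, by simp [hy, hz]⟩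
  | tmul s k =>
    obtain ⟨k, hk⟩ := k
    obtain ⟨p, rfl⟩ := IsIntegrallyClosed.isIntegral_iff.mp hk
    refine ⟨p • s, ?_⟩
    change (p • s) ⊗ₜ[P] (1 : K) = s ⊗ₜ[P] algebraMap P K p
    rw [Algebra.algebraMap_eq_smul_one, TensorProduct.smul_tmul]

section Scheme

variable {Y : Scheme.{0}} (sY : Y ⟶ SpecC)

/-- A smooth scheme is locally étale over an affine space, whose coordinate ring is factorial and so
integrally closed. -/
theorem exists_isIntegrallyClosed_section [IsIntegral Y] [Smooth sY] (y : Y) :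
    ∃ V : Y.Opens, IsAffineOpen V ∧ y ∈ V ∧ IsIntegrallyClosed Γ(Y, V) := by
  obtain ⟨U, hU, V, hV, hy, e, h⟩ := Smooth.exists_isStandardSmooth sY y
  refine ⟨V, hV, hy, ?_⟩
  obtain ⟨n, g, -, hg⟩ := h.exists_etale_mvPolynomial
  have hUtop : U = ⊤ := by
    rw [eq_top_iff]
    intro z _
    rw [Subsingleton.elim z (sY y)]
    exact e hy
  subst hUtop
  have eC : ℂ ≃+* Γ(SpecC, ⊤) := (Scheme.ΓSpecIso (CommRingCat.of ℂ)).commRingCatIsoToRingEquiv.symm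
  have : IsDomain Γ(SpecC, ⊤) := eC.symm.toMulEquiv.isDomain _
  have : UniqueFactorizationMonoid Γ(SpecC, ⊤) :=
    eC.toMulEquiv.uniqueFactorizationMonoid inferInstance
  have : Nonempty V := ⟨⟨y, hy⟩⟩
  let := g.toAlgebra
  have : Algebra.Etale (MvPolynomial (Fin n) Γ(SpecC, ⊤)) Γ(Y, V) := hg
  exact isIntegrallyClosed_of_etale (MvPolynomial (Fin n) Γ(SpecC, ⊤)) Γ(Y, V)

theorem isIntegrallyClosed_stalk [IsIntegral Y] [Smooth sY] (y : Y) :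
    IsIntegrallyClosed (Y.presheaf.stalk y) := by
  obtain ⟨V, hV, hy, h⟩ := exists_isIntegrallyClosed_section sY y
  have : Nonempty V := ⟨⟨y, hy⟩⟩
  let := Y.presheaf.algebra_section_stalk ⟨y, hy⟩
  have := hV.isLocalization_stalk ⟨y, hy⟩
  exact isIntegrallyClosed_of_isLocalization _ (hV.primeIdealOf ⟨y, hy⟩).asIdeal.primeCompl
    (Ideal.primeCompl_le_nonZeroDivisors _)

theorem isLocallyNoetherian_of_isCurve (hY : IsCurve sY) : IsLocallyNoetherian Y := by
  have := hY.locallyOfFiniteType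
  exact LocallyOfFiniteType.isLocallyNoetherian sY

theorem krullDimLE_one_stalk (hY : IsCurve sY) (y : Y) :
    Ring.KrullDimLE 1 (Y.presheaf.stalk y) := by
  have h := (Y.fromSpecStalk y).isEmbedding.isInducing.topologicalKrullDim_le
  rw [hY.dim_eq_one] at h
  have h' : topologicalKrullDim (PrimeSpectrum (Y.presheaf.stalk y)) ≤ 1 := h
  rw [PrimeSpectrum.topologicalKrullDim_eq_ringKrullDim] at h'
  rw [Ring.krullDimLE_iff]
  exact_mod_cast h'

theorem exists_ne_of_isCurve (hY : IsCurve sY) (q : Y) : ∃ y : Y, y ≠ q := by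
  by_contra! h
  have : Subsingleton Y := ⟨fun a b ↦ (h a).trans (h b).symm⟩
  have : Nonempty Y := ⟨q⟩
  have h₁ := topologicalKrullDim_zero_of_discreteTopology Y
  rw [hY.dim_eq_one] at h₁
  exact absurd h₁ (by decide)

/-- If the stalk at q were a field, q would be the generic point; being closed, it would be all of
Y, which has dimension one. -/
theorem not_isField_stalk (hY : IsCurve sY) {q : Y} (hq : IsClosed {q}) :
    ¬ IsField (Y.presheaf.stalk q) := by
  have := hY.isIntegral
  intro hf
  obtain ⟨y, hy⟩ := exists_ne_of_isCurve sY hY q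
  let := hf.toField
  have hη : genericPoint Y = q := by
    have h : genericPoint Y ∈ Set.range (Y.fromSpecStalk q) := by
      rw [Scheme.range_fromSpecStalk]
      exact (genericPoint_spec Y).specializes trivial
    obtain ⟨z, hz⟩ := h
    rw [← hz]
    refine Eq.trans ?_ (Scheme.fromSpecStalk_closedPoint (x := q))
    exact congrArg _ (Subsingleton.elim (α := PrimeSpectrum (Y.presheaf.stalk q)) _ _)
  have h := genericPoint_spec Y
  rw [hη, isGenericPoint_def, hq.closure_eq] at h
  exact hy (h.symm ▸ Set.mem_univ y : y ∈ ({q} : Set Y))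

theorem isDiscreteValuationRing_stalk (hY : IsCurve sY) [Smooth sY] {q : Y} (hq : IsClosed {q}) :
    haveI := hY.isIntegral
    IsDiscreteValuationRing (Y.presheaf.stalk q) := by
  have := hY.isIntegral
  have := isLocallyNoetherian_of_isCurve sY hY
  have := krullDimLE_one_stalk sY hY q
  have hf := not_isField_stalk sY hY hq
  have h : IsIntegrallyClosed (Y.presheaf.stalk q) ∧
      ∃! P : Ideal (Y.presheaf.stalk q), P ≠ ⊥ ∧ P.IsPrime := by
    refine ⟨isIntegrallyClosed_stalk sY q, ?_⟩
    refine ⟨maximalIdeal _, ⟨fun h ↦ hf (isField_iff_maximalIdeal_eq.mpr h), inferInstance⟩, ?_⟩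
    rintro P ⟨hP, hP'⟩
    exact eq_maximalIdeal (Ring.krullDimLE_one_iff_of_isPrime_bot.mp inferInstance P hP hP')
  exact ((IsDiscreteValuationRing.TFAE _ hf).out 3 0).mp h

theorem SpecMap_structureMap (y : Y) :
    Spec.map (CommRingCat.ofHom (structureMap sY y)) = Y.fromSpecStalk y ≫ sY := by
  refine ext_of_isAffine ?_
  rw [Scheme.Hom.comp_appTop, Scheme.fromSpecStalk_appTop,
    ← cancel_epi (Scheme.ΓSpecIso (CommRingCat.of ℂ)).inv, ← Scheme.ΓSpecIso_inv_naturality,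
    structureMap, CommRingCat.ofHom_hom]
  simp only [Category.assoc]
  congr 3

/-- By the Nullstellensatz the residue field at a closed point of a scheme locally of finite type
over ℂ is ℂ. -/
theorem exists_sub_structureMap_mem (hY : IsCurve sY) {q : Y} (hq : IsClosed {q})
    (a : LocalRingAt sY q) : ∃ c : ℂ, a - algebraMap ℂ _ c ∈ maximalIdeal (LocalRingAt sY q) := by
  have := hY.locallyOfFiniteType
  -- The isomorphism ℂ ≅ κ(q) must be the one given by the structure map; this is checked after
  -- applying Spec.
  have h : (residueFieldIsoBase sY q hq).inv =
      CommRingCat.ofHom (structureMap sY q) ≫ Y.residue q := by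
    apply Spec.map_injective
    rw [SpecMap_residueFieldIsoBase_inv, Spec.map_comp, SpecMap_structureMap,
      Scheme.fromSpecResidueField, Category.assoc]
  let b : Y.residueField q := (Y.residue q).hom a
  refine ⟨(residueFieldIsoBase sY q hq).hom b, ?_⟩
  have h₁ := congr(($h).hom ((residueFieldIsoBase sY q hq).hom b))
  have h₂ : (residueFieldIsoBase sY q hq).inv ((residueFieldIsoBase sY q hq).hom b) = b := by simp
  have h₃ : IsLocalRing.residue (Y.presheaf.stalk q)
      (structureMap sY q ((residueFieldIsoBase sY q hq).hom b)) =
      IsLocalRing.residue (Y.presheaf.stalk q) a := h₁.symm.trans h₂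
  exact Ideal.Quotient.eq.mp h₃.symm

theorem nonempty_completeLocalRing_algEquiv (hY : IsCurve sY) [Smooth sY] {q : Y}
    (hq : IsClosed {q}) : Nonempty (CompleteLocalRing sY q ≃ₐ[ℂ] ℂ⟦X⟧) := by
  have := hY.isIntegral
  have := isDiscreteValuationRing_stalk sY hY hq
  obtain ⟨τ, hτ⟩ := IsDiscreteValuationRing.exists_irreducible (Y.presheaf.stalk q)
  have : IsDomain (LocalRingAt sY q) := inferInstanceAs (IsDomain (Y.presheaf.stalk q))
  exact nonempty_completion_algEquiv (O := LocalRingAt sY q) (τ := τ) hτ.maximalIdeal_eq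
    hτ.ne_zero (exists_sub_structureMap_mem sY hY hq)

end Scheme

/-! ### Homeomorphisms with injective stalk maps -/

section Homeomorph

variable {X Y Z : Scheme.{0}} (π : Y ⟶ X)

theorem app_map_apply {U V : X.Opens} (h : V ≤ U) (b : Γ(X, U)) :
    π.app V (X.presheaf.map (homOfLE h).op b) =
      Y.presheaf.map (homOfLE (π.preimage_mono h)).op (π.app U b) := by
  rw [← CommRingCat.comp_apply, Scheme.Hom.naturality, CommRingCat.comp_apply]
  rfl

theorem map_map_apply {U V W : X.Opens} (i : V ⟶ U) (j : W ⟶ V) (b : Γ(X, U)) :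
    X.presheaf.map j.op (X.presheaf.map i.op b) = X.presheaf.map (j ≫ i).op b := by
  rw [← CommRingCat.comp_apply, ← Functor.map_comp, op_comp]

theorem germ_map_apply {U V : X.Opens} (h : V ≤ U) (x : X) (hx : x ∈ V) (b : Γ(X, U)) :
    X.presheaf.germ V x hx (X.presheaf.map (homOfLE h).op b) = X.presheaf.germ U x (h hx) b :=
  TopCat.Presheaf.germ_res_apply _ _ _ _ _

theorem app_injective_of_stalkMap_injective (hπ : Function.Surjective π)
    (hinj : ∀ y, Function.Injective (π.stalkMap y)) (W : X.Opens) :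
    Function.Injective (π.app W) := by
  intro s t hst
  refine TopCat.Presheaf.section_ext X.sheaf W s t fun x hx ↦ ?_
  obtain ⟨y, rfl⟩ := hπ x
  apply hinj y
  change π.stalkMap y (X.presheaf.germ W (π y) hx s) = π.stalkMap y (X.presheaf.germ W (π y) hx t)
  rw [Scheme.Hom.germ_stalkMap_apply, Scheme.Hom.germ_stalkMap_apply, hst]

/-- A section on `π ⁻¹ᵁ W` comes from `W` if its germs come from the stalks of `X`. -/
theorem mem_range_app_of_germ_mem_range (hπ : IsHomeomorph π)
    (hinj : ∀ y, Function.Injective (π.stalkMap y)) (W : X.Opens) (a : Γ(Y, π ⁻¹ᵁ W))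
    (ha : ∀ (y : Y) (hy : y ∈ π ⁻¹ᵁ W),
      Y.presheaf.germ (π ⁻¹ᵁ W) y hy a ∈ Set.range (π.stalkMap y)) :
    a ∈ Set.range (π.app W) := by
  have hloc (x : W) : ∃ (U : X.Opens) (hxU : x.1 ∈ U) (hUW : U ≤ W) (b : Γ(X, U)),
      π.app U b = Y.presheaf.map (homOfLE (π.preimage_mono hUW)).op a := by
    obtain ⟨x, hx⟩ := x
    obtain ⟨y, rfl⟩ := hπ.surjective x
    obtain ⟨t, ht⟩ := ha y hx
    obtain ⟨U, hxU, b, rfl⟩ := X.presheaf.exists_germ_eq t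
    rw [Scheme.Hom.germ_stalkMap_apply] at ht
    obtain ⟨N, hyN, i₁, i₂, h⟩ := Y.presheaf.germ_eq y _ _ _ _ ht
    -- A neighbourhood in Y on which the two sections agree has open image in X, so the local lift
    -- lives there.
    let U' : X.Opens := ⟨π '' N, hπ.isOpenMap _ N.2⟩
    have hU' : π ⁻¹ᵁ U' = N := by
      ext z
      exact hπ.injective.mem_set_image
    have hUU : U' ≤ U := by
      rintro _ ⟨z, hz, rfl⟩
      exact i₁.le hz
    have hUW : U' ≤ W := by
      rintro _ ⟨z, hz, rfl⟩
      exact i₂.le hz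
    refine ⟨U', ⟨y, hyN, rfl⟩, hUW, X.presheaf.map (homOfLE hUU).op b, ?_⟩
    have h' := congr(Y.presheaf.map (homOfLE hU'.le).op $h)
    rw [map_map_apply, map_map_apply] at h'
    rw [app_map_apply]
    exact h'
  choose U hxU hUW b hb using hloc
  have hai := app_injective_of_stalkMap_injective π hπ.surjective hinj
  obtain ⟨s, hs, -⟩ : ∃! s : Γ(X, W), ∀ x, X.presheaf.map (homOfLE (hUW x)).op s = b x :=
    X.sheaf.existsUnique_gluing' U W (fun x ↦ homOfLE (hUW x))
    (fun x hx ↦ Opens.mem_iSup.mpr ⟨⟨x, hx⟩, hxU _⟩) b (fun i j ↦ by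
      apply hai
      change π.app _ (X.presheaf.map _ _) = π.app _ (X.presheaf.map _ _)
      rw [Opens.infLELeft, Opens.infLERight, app_map_apply, app_map_apply, hb, hb, map_map_apply,
        map_map_apply]
      rfl)
  refine ⟨s, ?_⟩
  refine TopCat.Presheaf.section_ext Y.sheaf _ _ _ fun y hy ↦ ?_
  replace hy : π y ∈ W := hy
  have h := congr(π.app _ $(hs ⟨π y, hy⟩))
  rw [hb, app_map_apply] at h
  have h' := congr(Y.presheaf.germ _ y (hxU ⟨π y, hy⟩) $h)
  exact (germ_map_apply _ y _ _).symm.trans (h'.trans (germ_map_apply _ y _ _))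

/-- Two morphisms that agree after composition with such a `π` are equal. -/
theorem hom_ext_of_stalkMap_injective (hπ : Function.Surjective π)
    (hinj : ∀ y, Function.Injective (π.stalkMap y)) {g h : X ⟶ Z} (hgh : π ≫ g = π ≫ h) :
    g = h := by
  have hb : g.base = h.base := by
    ext x
    obtain ⟨y, rfl⟩ := hπ x
    exact congr(($hgh) y)
  refine Scheme.Hom.ext hb fun U ↦ ?_
  ext a
  apply app_injective_of_stalkMap_injective π hπ hinj
  have h₁ := congr(($(Scheme.Hom.congr_app hgh.symm U)) a)
  have hle : h ⁻¹ᵁ U ≤ g ⁻¹ᵁ U := fun x hx ↦ by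
    change g.base x ∈ U
    rw [hb]
    exact hx
  rw [Scheme.Hom.comp_app, Scheme.Hom.comp_app] at h₁
  refine Eq.trans ?_ h₁.symm
  exact app_map_apply π hle (g.app U a)

/-- The ring homomorphism underlying a factorization through an injective one. -/
theorem exists_ringHom_comp_eq {A B C : Type*} [CommRing A] [CommRing B] [CommRing C]
    (φ : A →+* B) (hφ : Function.Injective φ) (ψ : C →+* B) (h : ∀ c, ψ c ∈ Set.range φ) :
    ∃ θ : C →+* A, ∀ c, φ (θ c) = ψ c := by
  choose θ hθ using h
  refine ⟨⟨⟨⟨θ, ?_⟩, ?_⟩, ?_, ?_⟩, hθ⟩ <;> intros <;> apply hφ <;> simp [hθ]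

/-- A morphism `f : Y ⟶ Z` factors through a homeomorphism `π : Y ⟶ X` with injective stalk maps
if the stalks of `Z` map to the stalks of `X`. -/
theorem exists_comp_eq_of_range_stalkMap_le (hπ : IsHomeomorph π)
    (hinj : ∀ y, Function.Injective (π.stalkMap y)) (f : Y ⟶ Z)
    (hf : ∀ y, Set.range (f.stalkMap y) ⊆ Set.range (π.stalkMap y)) :
    ∃ g : X ⟶ Z, π ≫ g = f := by
  have hai := app_injective_of_stalkMap_injective π hπ.surjective hinj
  let e := hπ.homeomorph
  -- On points the factorization is forced to be f ∘ π⁻¹; on sections it is forced by the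
  -- injectivity of `π.app`.
  let g₀ : X.carrier ⟶ Z.carrier := TopCat.ofHom ⟨fun x ↦ f (e.symm x), by fun_prop⟩
  have hg₀ (y : Y) : g₀ (π y) = f y := congrArg f (e.symm_apply_apply y)
  have hle (U : Z.Opens) : π ⁻¹ᵁ ((Opens.map g₀).obj U) ≤ f ⁻¹ᵁ U := fun y hy ↦ by
    have : g₀ (π y) ∈ U := hy
    rwa [hg₀] at this
  have hr (U : Z.Opens) (a : Γ(Z, U)) : f.appLE U _ (hle U) a ∈
      Set.range (π.app ((Opens.map g₀).obj U)) := by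
    refine mem_range_app_of_germ_mem_range π hπ hinj _ _ fun y hy ↦ ?_
    have h := germ_map_apply (hle U) y hy (f.app U a)
    rw [Scheme.Hom.appLE, CommRingCat.comp_apply]
    exact hf y ⟨_, (Scheme.Hom.germ_stalkMap_apply f U y (hle U hy) a).trans h.symm⟩
  choose c hc using fun U ↦ exists_ringHom_comp_eq (π.app ((Opens.map g₀).obj U)).hom (hai _)
    (f.appLE U _ (hle U)).hom (hr U)
  let g₁ : X.toPresheafedSpace ⟶ Z.toPresheafedSpace :=
    { base := g₀
      c :=
        { app U := CommRingCat.ofHom (c U.unop)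
          naturality U V i := by
            ext a
            apply hai
            have h₁ := app_map_apply π (U := (Opens.map g₀).obj U.unop)
              (V := (Opens.map g₀).obj V.unop) (fun x hx ↦ i.unop.le hx) (c U.unop a)
            have h₂ := hc V.unop (Z.presheaf.map i a)
            refine h₂.trans (Eq.trans ?_ h₁.symm)
            refine Eq.trans ?_ congr(Y.presheaf.map _ $(hc U.unop a)).symm
            change (Z.presheaf.map i ≫ f.appLE V.unop _ (hle V.unop)) a =
              (f.appLE U.unop _ (hle U.unop) ≫ Y.presheaf.map _) a
            rw [Scheme.Hom.map_appLE, Scheme.Hom.appLE_map] } }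
  -- A germ of Z that becomes a unit in a stalk of X becomes a unit in the stalk of Y, and f is
  -- local.
  have hloc (x : X) : IsLocalHom (g₁.stalkMap x).hom := by
    obtain ⟨y, rfl⟩ := hπ.surjective x
    refine ⟨fun z hz ↦ ?_⟩
    obtain ⟨U, hU, a, rfl⟩ := Z.presheaf.exists_germ_eq z
    have h₁ : IsUnit (X.presheaf.germ ((Opens.map g₀).obj U) (π y) hU (c U a)) := by
      have h := congr(($(PresheafedSpace.stalkMap_germ g₁ U (π y) hU)) a)
      exact (congrArg IsUnit h).mp hz
    have h₂ := h₁.map (π.stalkMap y).hom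
    have h₃ : IsUnit (f.stalkMap y (Z.presheaf.germ U (f y) (hle U hU) a)) := by
      have h₃ := Scheme.Hom.germ_stalkMap_apply π ((Opens.map g₀).obj U) y hU (c U a)
      have h₄ := Scheme.Hom.germ_stalkMap_apply f U y (hle U hU) a
      have h₅ := germ_map_apply (hle U) y hU (f.app U a)
      refine (congrArg IsUnit (h₃.trans (Eq.trans ?_ (h₅.trans h₄.symm)))).mp h₂
      exact congrArg _ (hc U a)
    have h₄ : f y ∈ Z.basicOpen a :=
      (Z.mem_basicOpen a (f y) (hle U hU)).mpr (isUnit_of_map_unit (f.stalkMap y).hom _ h₃)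
    rw [← hg₀] at h₄
    exact (Z.mem_basicOpen a _ hU).mp h₄
  let g : X ⟶ Z := ⟨⟨g₁, hloc⟩⟩
  have hmap (U : Z.Opens) (i : π ⁻¹ᵁ ((Opens.map g₀).obj U) = f ⁻¹ᵁ U) :
      f.appLE U _ (hle U) ≫ Y.presheaf.map (eqToHom i.symm).op = f.app U := by
    rw [Scheme.Hom.appLE_map, Scheme.Hom.appLE_eq_app]
  have hpre (U : Z.Opens) : π ⁻¹ᵁ ((Opens.map g₀).obj U) = f ⁻¹ᵁ U := by
    ext y
    exact (congrArg (· ∈ U) (hg₀ y)).to_iff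
  refine ⟨g, Scheme.Hom.ext ?_ fun U ↦ ?_⟩
  · ext y
    exact hg₀ y
  · ext a
    have h : (π ≫ g).app U a = f.appLE U _ (hle U) a := hc U a
    refine (CommRingCat.comp_apply _ _ _).trans ((congrArg _ h).trans ?_)
    exact congr($(hmap U (hpre U)) a)

/-- Two homeomorphisms out of `Y` with injective stalk maps and the same stalks differ by an
isomorphism. -/
theorem exists_iso_of_range_stalkMap_eq {X' : Scheme.{0}} (π' : Y ⟶ X')
    (hπ : IsHomeomorph π) (hinj : ∀ y, Function.Injective (π.stalkMap y))
    (hπ' : IsHomeomorph π') (hinj' : ∀ y, Function.Injective (π'.stalkMap y))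
    (h : ∀ y, Set.range (π.stalkMap y) = Set.range (π'.stalkMap y)) :
    ∃ e : X ≅ X', π ≫ e.hom = π' := by
  obtain ⟨g, hg⟩ := exists_comp_eq_of_range_stalkMap_le π hπ hinj π' fun y ↦ (h y).ge
  obtain ⟨g', hg'⟩ := exists_comp_eq_of_range_stalkMap_le π' hπ' hinj' π fun y ↦ (h y).le
  refine ⟨⟨g, g', ?_, ?_⟩, hg⟩
  · exact hom_ext_of_stalkMap_injective π hπ.surjective hinj (by simp [reassoc_of% hg, hg'])
  · exact hom_ext_of_stalkMap_injective π' hπ'.surjective hinj' (by simp [reassoc_of% hg', hg])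

end Homeomorph

/-! ### The ideal of a point in an affine open set -/

section PointIdeal

variable {Y : Scheme.{0}} {V : Y.Opens}

/-- The ideal of the functions on `V` that vanish at `y`. -/
noncomputable def pointIdeal (V : Y.Opens) (y : Y) (hy : y ∈ V) : Ideal Γ(Y, V) :=
  (maximalIdeal (Y.presheaf.stalk y)).comap (Y.presheaf.germ V y hy).hom

theorem mem_pointIdeal {y : Y} {hy : y ∈ V} {a : Γ(Y, V)} :
    a ∈ pointIdeal V y hy ↔ ¬ IsUnit (Y.presheaf.germ V y hy a) :=
  Iff.rfl

instance isPrime_pointIdeal (y : Y) (hy : y ∈ V) : (pointIdeal V y hy).IsPrime :=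
  inferInstanceAs ((maximalIdeal (Y.presheaf.stalk y)).comap (Y.presheaf.germ V y hy).hom).IsPrime

theorem primeIdealOf_asIdeal (hV : IsAffineOpen V) (y : Y) (hy : y ∈ V) :
    (hV.primeIdealOf ⟨y, hy⟩).asIdeal = pointIdeal V y hy := by
  let := Y.presheaf.algebra_section_stalk ⟨y, hy⟩
  have := hV.isLocalization_stalk ⟨y, hy⟩
  ext a
  have h := IsLocalization.AtPrime.isUnit_to_map_iff (Y.presheaf.stalk y)
    (hV.primeIdealOf ⟨y, hy⟩).asIdeal a
  rw [mem_pointIdeal]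
  exact ((not_congr h).trans not_not).symm

theorem isMaximal_pointIdeal (hV : IsAffineOpen V) {q : Y} (hqV : q ∈ V) (hq : IsClosed {q}) :
    (pointIdeal V q hqV).IsMaximal := by
  rw [← primeIdealOf_asIdeal hV]
  exact hV.primeIdealOf_isMaximal_of_isClosed ⟨q, hqV⟩ hq

theorem pointIdeal_injective (hV : IsAffineOpen V) {y z : Y} {hy : y ∈ V} {hz : z ∈ V}
    (h : pointIdeal V y hy = pointIdeal V z hz) : y = z := by
  rw [← primeIdealOf_asIdeal hV, ← primeIdealOf_asIdeal hV] at h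
  have h' := congrArg hV.fromSpec (PrimeSpectrum.ext h)
  rwa [hV.fromSpec_primeIdealOf, hV.fromSpec_primeIdealOf] at h'

/-- Otherwise the ideal of q would lie in that of y, and by maximality y = q. Multiplication by i
moves every function into the subring under study without changing divisibility at y. -/
theorem exists_isUnit_germ_of_ne (hV : IsAffineOpen V) {q : Y} (hqV : q ∈ V) (hq : IsClosed {q})
    {y : Y} (hy : y ∈ V) (hyq : y ≠ q) (M : ℕ) :
    ∃ i ∈ pointIdeal V q hqV ^ M, IsUnit (Y.presheaf.germ V y hy i) := by
  by_contra! h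
  have hle : pointIdeal V q hqV ≤ pointIdeal V y hy :=
    Ideal.IsPrime.le_of_pow_le fun i hi ↦ mem_pointIdeal.mpr (h i hi)
  exact hyq (pointIdeal_injective hV
    ((isMaximal_pointIdeal hV hqV hq).eq_of_le (isPrime_pointIdeal y hy).ne_top hle)).symm

theorem exists_mul_germ_eq (hV : IsAffineOpen V) {y : Y} (hy : y ∈ V) (z : Y.presheaf.stalk y) :
    ∃ a s, IsUnit (Y.presheaf.germ V y hy s) ∧
      z * Y.presheaf.germ V y hy s = Y.presheaf.germ V y hy a := by
  let := Y.presheaf.algebra_section_stalk ⟨y, hy⟩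
  have := hV.isLocalization_stalk ⟨y, hy⟩
  obtain ⟨⟨a, s⟩, h⟩ := IsLocalization.surj (hV.primeIdealOf ⟨y, hy⟩).asIdeal.primeCompl z
  exact ⟨a, s, IsLocalization.map_units _ s, h⟩

/-- An element coprime to an ideal element is coprime to its powers, so inverses modulo 𝔮 lift to
inverses modulo 𝔮^M. -/
theorem exists_mul_sub_one_mem_pow {A : Type*} [CommRing A] {𝔮 : Ideal A} [h𝔮 : 𝔮.IsMaximal]
    {s : A} (hs : s ∉ 𝔮) (M : ℕ) : ∃ w, s * w - 1 ∈ 𝔮 ^ M := by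
  obtain ⟨w, i, hi, h⟩ := h𝔮.exists_inv hs
  have hc : IsCoprime s i := ⟨w, 1, by rw [one_mul, h]⟩
  obtain ⟨u, v, h⟩ := hc.pow_right (n := M)
  refine ⟨u, ?_⟩
  rw [show s * u - 1 = -(v * i ^ M) by rw [← h]; ring]
  exact neg_mem (Ideal.mul_mem_left _ _ (Ideal.pow_mem_pow hi M))

theorem exists_mul_sub_one_mem_pointIdeal_pow (hV : IsAffineOpen V) {q : Y} (hqV : q ∈ V)
    (hq : IsClosed {q}) {s : Γ(Y, V)} (hs : IsUnit (Y.presheaf.germ V q hqV s)) (M : ℕ) :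
    ∃ w, s * w - 1 ∈ pointIdeal V q hqV ^ M :=
  haveI := isMaximal_pointIdeal hV hqV hq
  exists_mul_sub_one_mem_pow (fun h ↦ mem_pointIdeal.mp h hs) M

theorem germ_mem_pow {q : Y} {hqV : q ∈ V} {M : ℕ} {i : Γ(Y, V)}
    (hi : i ∈ pointIdeal V q hqV ^ M) :
    Y.presheaf.germ V q hqV i ∈ maximalIdeal (Y.presheaf.stalk q) ^ M :=
  Ideal.le_comap_pow _ M hi

/-- Functions on `V` whose germ at `q` vanishes to order `M` lie in the power of the ideal. -/
theorem mem_pointIdeal_pow (hV : IsAffineOpen V) {q : Y} (hqV : q ∈ V) (hq : IsClosed {q})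
    {M : ℕ} {a : Γ(Y, V)}
    (ha : Y.presheaf.germ V q hqV a ∈ maximalIdeal (Y.presheaf.stalk q) ^ M) :
    a ∈ pointIdeal V q hqV ^ M := by
  let := Y.presheaf.algebra_section_stalk ⟨q, hqV⟩
  have := hV.isLocalization_stalk ⟨q, hqV⟩
  have := isMaximal_pointIdeal hV hqV hq
  have hp := primeIdealOf_asIdeal hV q hqV
  have hmax : maximalIdeal (Y.presheaf.stalk q) =
      (pointIdeal V q hqV).map (algebraMap Γ(Y, V) (Y.presheaf.stalk q)) := by
    rw [← hp]
    exact (IsLocalization.AtPrime.map_eq_maximalIdeal _ _).symm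
  rw [hmax, ← Ideal.map_pow] at ha
  obtain ⟨⟨i, s⟩, h⟩ := (IsLocalization.mem_map_algebraMap_iff
    (hV.primeIdealOf ⟨q, hqV⟩).asIdeal.primeCompl _).mp ha
  have h' : algebraMap Γ(Y, V) (Y.presheaf.stalk q) (a * s) =
      algebraMap Γ(Y, V) (Y.presheaf.stalk q) i := by
    rw [map_mul]
    exact h
  obtain ⟨t, ht⟩ := (IsLocalization.eq_iff_exists
    (hV.primeIdealOf ⟨q, hqV⟩).asIdeal.primeCompl _).mp h'
  have hts : (t * s : Γ(Y, V)) ∉ pointIdeal V q hqV := by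
    rw [← hp]
    exact (t * s).2
  -- The denominators are invertible modulo 𝔮^M, so they can be divided out at the cost of an
  -- element of 𝔮^M.
  obtain ⟨w, hw⟩ := exists_mul_sub_one_mem_pow hts M
  have h₁ : a * (t * s) ∈ pointIdeal V q hqV ^ M := by
    rw [show a * (t * s : Γ(Y, V)) = t * (a * s) by ring, ht]
    exact Ideal.mul_mem_left _ _ i.2
  rw [show a = a * (t * s) * w - a * (t * s * w - 1) by ring]
  exact sub_mem (Ideal.mul_mem_right _ _ h₁) (Ideal.mul_mem_left _ _ hw)

end PointIdeal

/-! ### Stalk maps over an affine open set -/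

section Affine

variable {X Y : Scheme.{0}} (π : Y ⟶ X) {W : X.Opens}

theorem mem_range_stalkMap_of_mul_eq {y : Y} (hy : π y ∈ W) {z : Y.presheaf.stalk y}
    {b t : Γ(X, W)} (ht : IsUnit (Y.presheaf.germ (π ⁻¹ᵁ W) y hy (π.app W t)))
    (h : z * Y.presheaf.germ (π ⁻¹ᵁ W) y hy (π.app W t) =
      Y.presheaf.germ (π ⁻¹ᵁ W) y hy (π.app W b)) :
    z ∈ Set.range (π.stalkMap y) := by
  rw [← Scheme.Hom.germ_stalkMap_apply] at ht h
  rw [← Scheme.Hom.germ_stalkMap_apply] at h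
  obtain ⟨u, hu⟩ := isUnit_of_map_unit (π.stalkMap y).hom _ ht
  refine ⟨X.presheaf.germ W (π y) hy b * ↑u⁻¹, ?_⟩
  rw [map_mul, ← h, ← hu, mul_assoc, ← map_mul, Units.mul_inv, map_one, mul_one]

theorem stalkMap_injective_of_app_injective [IsIntegral Y] (hW : IsAffineOpen W)
    (hinj : Function.Injective (π.app W)) {y : Y} (hy : π y ∈ W) :
    Function.Injective (π.stalkMap y) := by
  refine hW.stalkMap_injective π y hy fun g hg ↦ ?_
  rw [Scheme.Hom.germ_stalkMap_apply] at hg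
  have h₁ : π.app W g = 0 := germ_injective_of_isIntegral _ y hy (hg.trans (map_zero _).symm)
  rw [hinj (h₁.trans (map_zero _).symm), map_zero]

variable (hV : IsAffineOpen (π ⁻¹ᵁ W)) {q : Y} (hqV : q ∈ π ⁻¹ᵁ W) (hq : IsClosed {q}) {M : ℕ}
  (hM : ∀ i ∈ pointIdeal (π ⁻¹ᵁ W) q hqV ^ M, i ∈ Set.range (π.app W))

include hV hq hM

/-- A fraction a / s equals (i a) / (i s). With i in the M-th power of the ideal of q, both terms
come from W, and with i a unit at y the denominator stays invertible. -/
theorem stalkMap_surjective_of_ne {y : Y} (hy : y ∈ π ⁻¹ᵁ W) (hyq : y ≠ q) :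
    Function.Surjective (π.stalkMap y) := by
  intro z
  obtain ⟨a, s, hs, h⟩ := exists_mul_germ_eq hV hy z
  obtain ⟨i, hi, hu⟩ := exists_isUnit_germ_of_ne hV hqV hq hy hyq M
  obtain ⟨b, hb⟩ := hM (i * a) (Ideal.mul_mem_right _ _ hi)
  obtain ⟨t, ht⟩ := hM (i * s) (Ideal.mul_mem_right _ _ hi)
  refine mem_range_stalkMap_of_mul_eq π hy (b := b) (t := t) ?_ ?_
  · rw [ht, map_mul]
    exact hu.mul hs
  · rw [hb, ht, map_mul, map_mul, ← h]
    ring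

/-- Every germ at `q` is the quotient of a section by a section coming from `W`. -/
theorem exists_mul_germ_app_eq (z : Y.presheaf.stalk q) :
    ∃ (a : Γ(Y, π ⁻¹ᵁ W)) (t : Γ(X, W)),
      IsUnit (Y.presheaf.germ (π ⁻¹ᵁ W) q hqV (π.app W t)) ∧
      z * Y.presheaf.germ (π ⁻¹ᵁ W) q hqV (π.app W t) = Y.presheaf.germ (π ⁻¹ᵁ W) q hqV a := by
  obtain ⟨a, s, hs, h⟩ := exists_mul_germ_eq hV hqV z
  -- The exponent M + 1 ensures that s w - 1 vanishes at q even if M = 0, so that s w is a unit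
  -- there.
  obtain ⟨w, hw⟩ := exists_mul_sub_one_mem_pointIdeal_pow hV hqV hq hs (M + 1)
  obtain ⟨t, ht⟩ := hM _ (Ideal.pow_le_pow_right (Nat.le_succ M) hw)
  have ht' : π.app W (t + 1) = s * w := by
    rw [map_add, map_one, ht]
    ring
  refine ⟨a * w, t + 1, ?_, ?_⟩
  · rw [ht']
    have h₁ : s * w - 1 ∈ pointIdeal _ q hqV := Ideal.pow_le_self (Nat.succ_ne_zero M) hw
    by_contra h₂
    have := sub_mem (mem_pointIdeal.mpr h₂) h₁
    rw [sub_sub_cancel] at this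
    exact (Ideal.ne_top_iff_one _).mp (isPrime_pointIdeal q hqV).ne_top this
  · rw [ht', map_mul, map_mul, ← h]
    ring

theorem mem_range_stalkMap_of_mem_pow {z : Y.presheaf.stalk q}
    (hz : z ∈ maximalIdeal (Y.presheaf.stalk q) ^ M) : z ∈ Set.range (π.stalkMap q) := by
  obtain ⟨a, t, ht, h⟩ := exists_mul_germ_app_eq π hV hqV hq hM z
  obtain ⟨b, hb⟩ := hM a (mem_pointIdeal_pow hV hqV hq (h ▸ Ideal.mul_mem_right _ _ hz))
  exact mem_range_stalkMap_of_mul_eq π hqV ht (by rw [hb, h])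

/-- If the sections coming from `W` are those whose germs at `q` lie in `S`, then the stalk map
at `q` has range `S`. -/
theorem range_stalkMap_eq_of_range_app_eq (hW : IsAffineOpen W) (S : Subring (Y.presheaf.stalk q))
    (hS : ∀ u v, u * v = 1 → u ∈ S → v ∈ S)
    (hr : ∀ a, a ∈ Set.range (π.app W) ↔ Y.presheaf.germ (π ⁻¹ᵁ W) q hqV a ∈ S) :
    Set.range (π.stalkMap q) = S := by
  ext z
  constructor
  · rintro ⟨x, rfl⟩
    have hqW : π q ∈ W := hqV
    obtain ⟨b, t, ht, h⟩ := exists_mul_germ_eq hW hqW x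
    have h' := congr(π.stalkMap q $h)
    rw [map_mul, Scheme.Hom.germ_stalkMap_apply, Scheme.Hom.germ_stalkMap_apply] at h'
    replace ht := ht.map (π.stalkMap q).hom
    obtain ⟨v, hv⟩ := isUnit_iff_exists_inv.mp ht
    have hv' : Y.presheaf.germ (π ⁻¹ᵁ W) q hqV (π.app W t) * v = 1 :=
      (congrArg (· * v) (Scheme.Hom.germ_stalkMap_apply π W q hqW t)).symm.trans hv
    have hvS := hS _ _ hv' ((hr _).mp ⟨t, rfl⟩)
    have hx : π.stalkMap q x = Y.presheaf.germ (π ⁻¹ᵁ W) q hqV (π.app W b) * v := by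
      rw [← h', mul_assoc, hv', mul_one]
    rw [hx]
    exact S.mul_mem ((hr _).mp ⟨b, rfl⟩) hvS
  · intro hz
    obtain ⟨a, t, ht, h⟩ := exists_mul_germ_app_eq π hV hqV hq hM z
    have htS := (hr _).mp ⟨t, rfl⟩
    obtain ⟨b, hb⟩ := (hr a).mpr (h ▸ S.mul_mem hz htS)
    exact mem_range_stalkMap_of_mul_eq π hqV ht (by rw [hb, h])

end Affine

/-! ### Spectra of rings that agree up to a power of a maximal ideal -/

/-- Integrality makes the map closed and surjective. For injectivity, the only prime containing 𝔮^M
is 𝔮, and any other prime Q is recovered from its contraction by multiplying with an element of 𝔮^M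
outside Q. -/
theorem isHomeomorph_comap_of_pow_le {A B : Type*} [CommRing A] [CommRing B] (φ : B →+* A)
    (hφ : Function.Injective φ) (hint : φ.IsIntegral) (𝔮 : Ideal A) [h𝔮 : 𝔮.IsMaximal] (M : ℕ)
    (hM : ∀ i ∈ 𝔮 ^ M, i ∈ Set.range φ) : IsHomeomorph (PrimeSpectrum.comap φ) := by
  rw [isHomeomorph_iff_continuous_isClosedMap_bijective]
  refine ⟨PrimeSpectrum.continuous_comap φ, PrimeSpectrum.isClosedMap_comap_of_isIntegral φ hint,
    ?_, ?_⟩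
  · have key (P Q : PrimeSpectrum A) (h : PrimeSpectrum.comap φ P = PrimeSpectrum.comap φ Q)
        (hQ : ¬ 𝔮 ^ M ≤ Q.asIdeal) : P.asIdeal ≤ Q.asIdeal := by
      obtain ⟨i, hi, hiQ⟩ := Set.not_subset.mp hQ
      intro a ha
      obtain ⟨b, hb⟩ := hM (i * a) (Ideal.mul_mem_right _ _ hi)
      have hbP : b ∈ (PrimeSpectrum.comap φ P).asIdeal := by
        change φ b ∈ P.asIdeal
        rw [hb]
        exact Ideal.mul_mem_left _ _ ha
      rw [h] at hbP
      have hbQ : φ b ∈ Q.asIdeal := hbP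
      rw [hb] at hbQ
      exact (Q.2.mem_or_mem hbQ).resolve_left hiQ
    have hsub (P Q : PrimeSpectrum A) (h : PrimeSpectrum.comap φ P = PrimeSpectrum.comap φ Q)
        (hP : 𝔮 ^ M ≤ P.asIdeal) : 𝔮 ^ M ≤ Q.asIdeal := by
      intro i hi
      obtain ⟨b, rfl⟩ := hM i hi
      have hb : b ∈ (PrimeSpectrum.comap φ P).asIdeal := hP hi
      rw [h] at hb
      exact hb
    have hmax (P : PrimeSpectrum A) (hP : 𝔮 ^ M ≤ P.asIdeal) : P.asIdeal = 𝔮 :=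
      (h𝔮.eq_of_le P.2.ne_top (P.2.le_of_pow_le hP)).symm
    intro P Q h
    refine PrimeSpectrum.ext ?_
    by_cases hP : 𝔮 ^ M ≤ P.asIdeal
    · rw [hmax P hP, hmax Q (hsub P Q h hP)]
    · exact le_antisymm (key P Q h fun hQ ↦ hP (hsub Q P h.symm hQ)) (key Q P h.symm hP)
  · exact hint.comap_surjective hφ

/-! ### The conductor of a finite morphism with prescribed range on stalks -/

section Conductor

variable {X Y : Scheme.{0}} (π : Y ⟶ X)

/-- As b vanishes at π q, the basic open set of b misses that point, so every section of Y over it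
comes from X. Clearing denominators gives the power of b; the point y serves to test equality on
germs. -/
theorem exists_pow_mul_mem_range_app (hπ : IsHomeomorph π)
    (hinj : ∀ y, Function.Injective (π.stalkMap y)) {q : Y}
    (hsurj : ∀ y, y ≠ q → Function.Surjective (π.stalkMap y))
    [IsIntegral Y] {W : X.Opens} (hW : IsAffineOpen W) (hqW : π q ∈ W)
    {b : Γ(X, W)} (hb : b ∈ pointIdeal W (π q) hqW) {y : Y} (hy : y ∈ π ⁻¹ᵁ X.basicOpen b)
    (a : Γ(Y, π ⁻¹ᵁ W)) : ∃ n, π.app W b ^ n * a ∈ Set.range (π.app W) := by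
  have hle := X.basicOpen_le b
  obtain ⟨c, hc⟩ := mem_range_app_of_germ_mem_range π hπ hinj (X.basicOpen b)
    (Y.presheaf.map (homOfLE (π.preimage_mono hle)).op a) fun z hz ↦ by
      refine hsurj z ?_ _
      rintro rfl
      exact mem_pointIdeal.mp hb ((X.mem_basicOpen b _ hqW).mp hz)
  have := hW.isLocalization_basicOpen b
  obtain ⟨⟨d, s, n, rfl⟩, h⟩ := IsLocalization.surj (Submonoid.powers b) c
  refine ⟨n, d, germ_injective_of_isIntegral Y y (π.preimage_mono hle hy) ?_⟩
  have h₁ := congr(Y.presheaf.germ _ y hy (π.app _ $h))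
  rw [map_mul, map_mul, hc] at h₁
  have h₂ (e : Γ(X, W)) : Y.presheaf.germ _ y hy (π.app (X.basicOpen b)
      (algebraMap Γ(X, W) Γ(X, X.basicOpen b) e)) =
        Y.presheaf.germ (π ⁻¹ᵁ W) y (π.preimage_mono hle hy) (π.app W e) :=
    (congrArg _ (app_map_apply π hle e)).trans (germ_map_apply (π.preimage_mono hle) y hy _)
  have h₃ := germ_map_apply (π.preimage_mono hle) y hy a
  have h₄ := h₂ (b ^ n)
  rw [map_mul, map_pow]
  rw [map_pow] at h₄
  refine (h₂ d).symm.trans (h₁.symm.trans ?_)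
  rw [mul_comm]
  refine congrArg₂ (· * ·) ?_ h₃
  refine Eq.trans ?_ (h₄.trans ?_)
  · rw [← map_pow]
  · rw [map_pow, map_pow]

/-- Finiteness makes the exponent uniform: take the maximum over a finite set of module generators.
-/
theorem exists_pow_mul_mem_range {A B : Type*} [CommRing A] [CommRing B] (φ : B →+* A)
    (hφ : φ.Finite) (b : B) (h : ∀ a, ∃ n, φ b ^ n * a ∈ Set.range φ) :
    ∃ n, ∀ a, φ b ^ n * a ∈ Set.range φ := by
  algebraize [φ]
  obtain ⟨T, hT⟩ := Module.Finite.fg_top (R := B) (M := A)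
  choose n hn using h
  have hmono (a : A) (k : ℕ) (hk : n a ≤ k) : φ b ^ k * a ∈ Set.range φ := by
    obtain ⟨c, hc⟩ := hn a
    refine ⟨b ^ (k - n a) * c, ?_⟩
    rw [map_mul, hc, map_pow, ← mul_assoc, ← pow_add, Nat.sub_add_cancel hk]
  refine ⟨T.sup n, fun a ↦ ?_⟩
  have ha : a ∈ Submodule.span B (T : Set A) := hT ▸ Submodule.mem_top
  induction ha using Submodule.span_induction with
  | mem x hx => exact hmono x _ (Finset.le_sup hx)
  | zero => exact ⟨0, by simp⟩
  | add x y _ _ hx hy =>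
    obtain ⟨c, hc⟩ := hx
    obtain ⟨d, hd⟩ := hy
    exact ⟨c + d, by rw [map_add, hc, hd, mul_add]⟩
  | smul e x _ hx =>
    obtain ⟨c, hc⟩ := hx
    refine ⟨e * c, ?_⟩
    rw [map_mul, hc, Algebra.smul_def, RingHom.algebraMap_toAlgebra]
    ring

/-- The ideal C below is the conductor. A prime of a point y ≠ q cannot contain it: a function b
vanishing at π q but not at π y has a power in C. So the ideal of q lies in the radical of C, and
noetherianity gives a power inside C. -/
theorem exists_pointIdeal_pow_le_range (hπ : IsHomeomorph π)
    (hinj : ∀ y, Function.Injective (π.stalkMap y)) {q : Y}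
    (hsurj : ∀ y, y ≠ q → Function.Surjective (π.stalkMap y))
    [IsIntegral Y] [IsLocallyNoetherian Y] [IsFinite π]
    {W : X.Opens} (hW : IsAffineOpen W) (hqW : π q ∈ W)
    (hp : IsClosed {π q}) :
    ∃ M, ∀ i ∈ pointIdeal (π ⁻¹ᵁ W) q hqW ^ M, i ∈ Set.range (π.app W) := by
  have hV : IsAffineOpen (π ⁻¹ᵁ W) := hW.preimage π
  have : IsNoetherianRing Γ(Y, π ⁻¹ᵁ W) := IsLocallyNoetherian.component_noetherian ⟨_, hV⟩
  let C : Ideal Γ(Y, π ⁻¹ᵁ W) :=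
    { carrier := {a | ∀ x, a * x ∈ Set.range (π.app W)}
      zero_mem' := fun x ↦ ⟨0, by simp⟩
      add_mem' := by
        intro a b ha hb x
        obtain ⟨c, hc⟩ := ha x
        obtain ⟨d, hd⟩ := hb x
        exact ⟨c + d, by rw [map_add, hc, hd, add_mul]⟩
      smul_mem' := by
        intro c a ha x
        rw [smul_eq_mul, mul_comm c a, mul_assoc]
        exact ha (c * x) }
  have hC : pointIdeal (π ⁻¹ᵁ W) q hqW ≤ C.radical := by
    rw [Ideal.radical_eq_sInf]
    refine le_sInf fun Q ⟨hCQ, hQ⟩ ↦ ?_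
    have hyV : hV.fromSpec ⟨Q, hQ⟩ ∈ π ⁻¹ᵁ W := by
      have : hV.fromSpec ⟨Q, hQ⟩ ∈ Set.range hV.fromSpec := ⟨_, rfl⟩
      rwa [hV.range_fromSpec] at this
    have hQy : pointIdeal (π ⁻¹ᵁ W) _ hyV = Q := by
      rw [← primeIdealOf_asIdeal hV]
      have := hV.fromSpec.isOpenEmbedding.injective (hV.fromSpec_primeIdealOf ⟨_, hyV⟩)
      rw [this]
    generalize hV.fromSpec ⟨Q, hQ⟩ = y at hyV hQy
    subst hQy
    by_cases hyq : y = q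
    · subst hyq
      exact le_rfl
    · exfalso
      have hyW : π y ∈ W := hyV
      obtain ⟨b, hb, hu⟩ := exists_isUnit_germ_of_ne hW hqW hp hyW
        (fun h ↦ hyq (hπ.injective h)) 1
      rw [pow_one] at hb
      obtain ⟨n, hn⟩ := exists_pow_mul_mem_range (π.app W).hom (π.finite_app W hW) b
        (exists_pow_mul_mem_range_app π hπ hinj hsurj hW hqW hb (y := y)
          ((X.mem_basicOpen b _ hyW).mpr hu))
      refine mem_pointIdeal.mp ((isPrime_pointIdeal y hyV).mem_of_pow_mem n (hCQ hn)) ?_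
      have h := hu.map (π.stalkMap y).hom
      have h' := Scheme.Hom.germ_stalkMap_apply π W y hyW b
      exact (congrArg IsUnit h').mp h
  obtain ⟨M, hM⟩ := Ideal.exists_pow_le_of_le_radical_of_fg hC (IsNoetherian.noetherian _)
  refine ⟨M, fun i hi ↦ ?_⟩
  have := hM hi 1
  rwa [mul_one] at this

end Conductor

/-! ### The normalisation map of a glued curve -/

namespace GluedCurve

variable {Y : Scheme.{0}} {sY : Y ⟶ SpecC} {q : Y} {Γ : AddSubmonoid ℕ} (G : GluedCurve sY q Γ)

/-- The complement of the marked point. -/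
abbrev away : G.X.Opens := ⟨{G.π q}ᶜ, G.isClosed_point.isOpen_compl⟩

theorem isIso_stalkMap {y : Y} (hy : y ≠ q) : IsIso (G.π.stalkMap y) := by
  have hyU : y ∈ G.π ⁻¹ᵁ G.away := fun h ↦ by
    have : y ∈ G.π ⁻¹' {G.π q} := h
    rw [G.preimage_point] at this
    exact hy this
  have : IsIso (G.π ∣_ G.away) := G.isIso_away
  have e := morphismRestrictStalkMap G.π G.away ⟨y, hyU⟩
  have h := ((isIso_iff_isIso_stalkMap (G.π ∣_ G.away)).mp this).2 ⟨y, hyU⟩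
  exact (MorphismProperty.isomorphisms CommRingCat).arrow_mk_iso_iff e |>.mp h

/-- Integral morphisms are closed. Bijectivity holds away from the marked point by the isomorphism
there, and over it because its fibre is {q}. -/
theorem isHomeomorph_π : IsHomeomorph G.π := by
  have : IsIso (G.π ∣_ G.away) := G.isIso_away
  have := G.isNormalisation.isIntegralHom
  rw [isHomeomorph_iff_continuous_isClosedMap_bijective]
  have hf : Function.Bijective (G.π ∣_ G.away) :=
    (TopCat.homeoOfIso (asIso (G.π ∣_ G.away).base)).bijective
  refine ⟨G.π.continuous, G.π.isClosedMap, fun y z h ↦ ?_, fun x ↦ ?_⟩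
  · by_cases hy : G.π y = G.π q
    · have h₁ : y ∈ G.π ⁻¹' {G.π q} := hy
      have h₂ : z ∈ G.π ⁻¹' {G.π q} := h.symm.trans hy
      rw [G.preimage_point] at h₁ h₂
      exact h₁.trans h₂.symm
    · have hz : G.π z ≠ G.π q := h ▸ hy
      have := @hf.1 ⟨y, hy⟩ ⟨z, hz⟩ (Subtype.ext
        ((morphismRestrict_base_coe G.π G.away ⟨y, hy⟩).trans
          (h.trans (morphismRestrict_base_coe G.π G.away ⟨z, hz⟩).symm)))
      exact congrArg Subtype.val this
  · by_cases hx : x = G.π q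
    · exact ⟨q, hx.symm⟩
    · obtain ⟨y, hy⟩ := hf.2 ⟨x, hx⟩
      refine ⟨y.1, ?_⟩
      exact (morphismRestrict_base_coe G.π _ y).symm.trans (congrArg Subtype.val hy)

/-- If b pulls back to zero, the preimage of its basic open set is empty; π is surjective, so the
basic open set is empty, and X is reduced, so b = 0. -/
theorem stalkMap_injective (hY : IsCurve sY) (y : Y) : Function.Injective (G.π.stalkMap y) := by
  have := hY.isIntegral
  have := G.isCurve.isIntegral
  have := G.isNormalisation.isIntegralHom
  obtain ⟨W, hW, hyW, -⟩ := exists_isAffineOpen_mem_and_subset (X := G.X) (x := G.π y)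
    (U := ⊤) trivial
  refine stalkMap_injective_of_app_injective G.π hW ?_ hyW
  rw [injective_iff_map_eq_zero]
  intro b hb
  rw [← basicOpen_eq_bot_iff, eq_bot_iff]
  intro x hx
  obtain ⟨z, rfl⟩ := G.isHomeomorph_π.surjective x
  have hz : z ∈ G.π ⁻¹ᵁ G.X.basicOpen b := hx
  rw [Scheme.preimage_basicOpen, hb, Scheme.basicOpen_zero] at hz
  exact hz.elim

theorem stalkMap_surjective {y : Y} (hy : y ≠ q) : Function.Surjective (G.π.stalkMap y) :=
  haveI := G.isIso_stalkMap hy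
  (ConcreteCategory.bijective_of_isIso (G.π.stalkMap y)).2

theorem exists_pow_le_range_stalkMap (hY : IsCurve sY) (hq : IsClosed {q}) :
    ∃ M, 0 < M ∧ ∀ a ∈ maximalIdeal (Y.presheaf.stalk q) ^ M, a ∈ Set.range (G.π.stalkMap q) := by
  have := hY.isIntegral
  have := isLocallyNoetherian_of_isCurve sY hY
  have : LocallyOfFiniteType G.π :=
    haveI : LocallyOfFiniteType (G.π ≫ G.s) := by
      rw [G.w]
      exact hY.locallyOfFiniteType
    locallyOfFiniteType_of_comp G.π G.s
  have : IsFinite G.π :=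
    (IsFinite.iff_isIntegralHom_and_locallyOfFiniteType _).mpr
      ⟨G.isNormalisation.isIntegralHom, inferInstance⟩
  obtain ⟨W, hW, hqW, -⟩ := exists_isAffineOpen_mem_and_subset (X := G.X) (x := G.π q)
    (U := ⊤) trivial
  obtain ⟨M, hM⟩ := exists_pointIdeal_pow_le_range G.π G.isHomeomorph_π (G.stalkMap_injective hY)
    (fun _ ↦ G.stalkMap_surjective) hW hqW G.isClosed_point
  refine ⟨M + 1, M.succ_pos, fun a ha ↦ ?_⟩
  exact mem_range_stalkMap_of_mem_pow G.π (hW.preimage G.π) hqW hq hM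
    (Ideal.pow_le_pow_right M.le_succ ha)

end GluedCurve

/-! ### Gluing along an open subscheme -/

section Gluing

open Limits

/-- Two schemes can be glued along a common open subscheme. -/
theorem exists_glue {D U T : Scheme.{0}} (f : D ⟶ U) (g : D ⟶ T) [hf : IsOpenImmersion f]
    [hg : IsOpenImmersion g] :
    ∃ (X : Scheme.{0}) (i : U ⟶ X) (j : T ⟶ X), IsOpenImmersion i ∧ IsOpenImmersion j ∧
      f ≫ i = g ≫ j ∧ (∀ x, x ∈ Set.range i ∨ x ∈ Set.range j) ∧
      ∀ u t, i u = j t → ∃ d, f d = u ∧ g d = t := by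
  let F : WidePushoutShape WalkingPair ⥤ Scheme.{0} := span f g
  have : ∀ {i j : WidePushoutShape WalkingPair} (a : i ⟶ j), IsOpenImmersion (F.map a) := by
    rintro _ _ (_ | (_ | _))
    · exact (F.map_id _).symm ▸ inferInstance
    · exact hf
    · exact hg
  have hd : (F ⋙ Scheme.forget).IsLocallyDirected := inferInstance
  have hthin : Quiver.IsThin (WidePushoutShape WalkingPair) := inferInstance
  have hι (i) : IsOpenImmersion (colimit.ι F i) :=
    (Scheme.IsLocallyDirected.openCover F).map_prop i
  refine ⟨colimit F, colimit.ι F (some .left), colimit.ι F (some .right), hι _, hι _, ?_,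
    fun x ↦ ?_, fun u t h ↦ ?_⟩
  · exact (colimit.w F (WidePushoutShape.Hom.init .left)).trans
      (colimit.w F (WidePushoutShape.Hom.init .right)).symm
  · obtain ⟨i, y, rfl⟩ := Scheme.IsLocallyDirected.ι_jointly_surjective F x
    match i, y with
    | none, y =>
      left
      refine ⟨f y, ?_⟩
      exact congr($(colimit.w F (WidePushoutShape.Hom.init .left)) y)
    | some .left, y => exact .inl ⟨y, rfl⟩
    | some .right, y => exact .inr ⟨y, rfl⟩
  -- Points of the two legs are identified only through a common source in the diagram, which can
  -- only be the apex D.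
  · obtain ⟨k, a, b, z, h₁, h₂⟩ := (Scheme.IsLocallyDirected.ι_eq_ι_iff F).mp h
    have aux : ∀ (k : WidePushoutShape WalkingPair) (a : WidePushoutShape.Hom k (some .left))
        (b : WidePushoutShape.Hom k (some .right)) (z : F.obj k), F.map a z = u → F.map b z = t →
        ∃ d, f d = u ∧ g d = t := by
      rintro _ a b z h₁ h₂
      cases a with
      | id => cases b
      | init => cases b with
        | init => exact ⟨z, h₁, h₂⟩
    exact aux k a b z h₁ h₂

/-- Morphisms can be glued along two open subschemes that cover. -/
theorem exists_glue_hom {X Y : Scheme.{0}} {U V : Y.Opens} (hUV : U ⊔ V = ⊤) (f : ↑U ⟶ X)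
    (g : ↑V ⟶ X) (h : Y.homOfLE inf_le_left ≫ f = Y.homOfLE (inf_le_right : U ⊓ V ≤ V) ≫ g) :
    ∃ k : Y ⟶ X, U.ι ≫ k = f ∧ V.ι ≫ k = g := by
  let W : Bool → Y.Opens := fun b ↦ cond b U V
  have hW : IsOpenCover W := by
    rw [IsOpenCover, ← hUV, iSup_bool_eq]
    rfl
  -- The fibre product of two open subschemes factors through their intersection, where the maps
  -- agree by hypothesis.
  have key : pullback.fst U.ι V.ι ≫ f = pullback.snd U.ι V.ι ≫ g := by
    have hr : Set.range (pullback.fst U.ι V.ι ≫ U.ι) ⊆ Set.range (U ⊓ V).ι := by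
      rintro _ ⟨x, rfl⟩
      rw [Scheme.Opens.range_ι]
      refine ⟨?_, ?_⟩
      · rw [Scheme.Hom.comp_apply]
        exact (pullback.fst U.ι V.ι x).2
      · rw [pullback.condition, Scheme.Hom.comp_apply]
        exact (pullback.snd U.ι V.ι x).2
    let l := IsOpenImmersion.lift (U ⊓ V).ι (pullback.fst U.ι V.ι ≫ U.ι) hr
    have hl : l ≫ (U ⊓ V).ι = pullback.fst U.ι V.ι ≫ U.ι := IsOpenImmersion.lift_fac ..
    have h₁ : l ≫ Y.homOfLE inf_le_left = pullback.fst U.ι V.ι := by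
      rw [← cancel_mono U.ι, Category.assoc, Scheme.homOfLE_ι, hl]
    have h₂ : l ≫ Y.homOfLE inf_le_right = pullback.snd U.ι V.ι := by
      rw [← cancel_mono V.ι, Category.assoc, Scheme.homOfLE_ι, hl, pullback.condition]
    rw [← h₁, ← h₂, Category.assoc, Category.assoc, h]
  let 𝒰 := Y.openCoverOfIsOpenCover W hW
  let φ : ∀ b, 𝒰.X b ⟶ X := fun b ↦ match b with
    | true => f
    | false => g
  have hφ : ∀ a b, pullback.fst (𝒰.f a) (𝒰.f b) ≫ φ a = pullback.snd _ _ ≫ φ b := by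
    rintro (_ | _) (_ | _)
    · exact congrArg (· ≫ g) ((cancel_mono V.ι).mp pullback.condition)
    · change pullback.fst V.ι U.ι ≫ g = pullback.snd V.ι U.ι ≫ f
      rw [← cancel_epi (pullbackSymmetry U.ι V.ι).hom, pullbackSymmetry_hom_comp_fst_assoc,
        pullbackSymmetry_hom_comp_snd_assoc, key]
    · exact key
    · exact congrArg (· ≫ f) ((cancel_mono U.ι).mp pullback.condition)
  exact ⟨𝒰.glueMorphisms φ hφ, 𝒰.ι_glueMorphisms φ hφ true, 𝒰.ι_glueMorphisms φ hφ false⟩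

end Gluing

/-! ### Replacing an open subscheme -/

section Pinch

theorem range_stalkMap_comp {X Y Z : Scheme.{0}} (f : X ⟶ Y) (g : Y ⟶ Z) (x : X) :
    Set.range ((f ≫ g).stalkMap x) = f.stalkMap x '' Set.range (g.stalkMap (f x)) := by
  rw [← Set.range_comp, Scheme.Hom.stalkMap_comp]
  rfl

theorem bijective_stalkMap {X Y : Scheme.{0}} (f : X ⟶ Y) [IsOpenImmersion f] (x : X) :
    Function.Bijective (f.stalkMap x) :=
  ConcreteCategory.bijective_of_isIso (f.stalkMap x)

variable {X Y T V : Scheme.{0}} {i : V ⟶ Y} {π : Y ⟶ X} {ρ : V ⟶ T} {j : T ⟶ X}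
  [IsOpenImmersion i] [IsOpenImmersion j] (h : i ≫ π = ρ ≫ j)

include h

/-- Open immersions are isomorphisms on stalks, so ranges of stalk maps may be computed in the local
model ρ. -/
theorem mem_range_stalkMap_iff_of_comm (v : V) (z : Y.presheaf.stalk (i v)) :
    z ∈ Set.range (π.stalkMap (i v)) ↔ i.stalkMap v z ∈ Set.range (ρ.stalkMap v) := by
  have h₁ := range_stalkMap_comp i π v
  have h₂ := range_stalkMap_comp ρ j v
  rw [(bijective_stalkMap j (ρ v)).2.range_eq, Set.image_univ] at h₂
  rw [← h₂, ← h, h₁, (bijective_stalkMap i v).1.mem_set_image]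

omit [IsOpenImmersion i] in
theorem stalkMap_injective_of_comm (v : V) (hv : Function.Injective (ρ.stalkMap v)) :
    Function.Injective (π.stalkMap (i v)) := by
  have h₁ : Function.Injective ((ρ ≫ j).stalkMap v) := by
    rw [Scheme.Hom.stalkMap_comp]
    exact hv.comp (bijective_stalkMap j (ρ v)).1
  rw [← h, Scheme.Hom.stalkMap_comp] at h₁
  exact Function.Injective.of_comp (f := i.stalkMap v) h₁

theorem stalkMap_injective_iff_of_comm (v : V) :
    Function.Injective (π.stalkMap (i v)) ↔ Function.Injective (ρ.stalkMap v) := by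
  refine ⟨fun hv ↦ ?_, stalkMap_injective_of_comm h v⟩
  have h₁ : Function.Injective ((i ≫ π).stalkMap v) := by
    rw [Scheme.Hom.stalkMap_comp]
    exact (bijective_stalkMap i v).1.comp hv
  rw [h, Scheme.Hom.stalkMap_comp] at h₁
  exact Function.Injective.of_comp_right (f := ρ.stalkMap v) (g := j.stalkMap (ρ v)) h₁
    (bijective_stalkMap j (ρ v)).2

theorem stalkMap_surjective_of_comm (v : V) (hv : Function.Surjective (ρ.stalkMap v)) :
    Function.Surjective (π.stalkMap (i v)) := fun z ↦
  (mem_range_stalkMap_iff_of_comm h v z).mpr (hv _)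

end Pinch

/-- An open neighbourhood `V` of a closed point `q` of `Y` can be replaced by a scheme `T`
homeomorphic to it that differs from it only at `q`. -/
theorem exists_pinch {Y T : Scheme.{0}} {V : Y.Opens} {q : Y} (hqV : q ∈ V) (hq : IsClosed {q})
    (ρ : ↑V ⟶ T) (hρ : IsHomeomorph ρ) (hinj : ∀ v, Function.Injective (ρ.stalkMap v))
    (hsurj : ∀ v : V, v.1 ≠ q → Function.Surjective (ρ.stalkMap v)) :
    ∃ (X : Scheme.{0}) (π : Y ⟶ X) (j : T ⟶ X) (_ : IsOpenImmersion j), V.ι ≫ π = ρ ≫ j ∧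
      π ⁻¹ᵁ j.opensRange = V ∧ IsHomeomorph π ∧ (∀ y, Function.Injective (π.stalkMap y)) ∧
      ∀ y, y ≠ q → Function.Surjective (π.stalkMap y) := by
  let U : Y.Opens := ⟨{q}ᶜ, hq.isOpen_compl⟩
  let g : ↑(U ⊓ V) ⟶ T := Y.homOfLE inf_le_right ≫ ρ
  -- Away from q the map ρ is a topological embedding with bijective stalk maps, so U ⊓ V is open in
  -- T as well, and T can be glued to U along it.
  have hg : IsOpenImmersion g := by
    have hiso (x : ((U ⊓ V : Y.Opens) : Scheme)) : IsIso (g.stalkMap x) := by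
      have : IsIso (ρ.stalkMap (Y.homOfLE inf_le_right x)) := by
        refine (ConcreteCategory.isIso_iff_bijective _).mpr ⟨hinj _, hsurj _ ?_⟩
        exact (congrArg (· ≠ q) (Scheme.homOfLE_apply inf_le_right x)).mpr x.2.1
      have h := Scheme.Hom.stalkMap_comp (Y.homOfLE inf_le_right) ρ x
      have : IsIso (ρ.stalkMap (Y.homOfLE inf_le_right x) ≫
        (Y.homOfLE (inf_le_right : U ⊓ V ≤ V)).stalkMap x) := inferInstance
      exact h ▸ this
    refine .of_isIso_stalkMap g ?_
    have := hρ.isOpenEmbedding.comp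
      (Y.homOfLE (inf_le_right : U ⊓ V ≤ V)).isOpenEmbedding
    exact this
  obtain ⟨X, i, j, hi, hj, hij, hcov, hglue⟩ := exists_glue (Y.homOfLE inf_le_left) g
  obtain ⟨π, hπU, hπV⟩ := exists_glue_hom (U := U) (V := V) (by
    ext y
    by_cases hy : y = q
    · subst hy
      simpa using Or.inr hqV
    · have : y ∈ U := hy
      simpa using Or.inl this) i (ρ ≫ j) (by rw [hij, Category.assoc])
  have hU (u : U) : π u.1 = i u := congr($hπU u)
  have hV (v : V) : π v.1 = j (ρ v) := congr($hπV v)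
  have hpre : π ⁻¹ᵁ j.opensRange = V := by
    ext y
    constructor
    · rintro ⟨t, ht⟩
      by_cases hy : y = q
      · exact hy ▸ hqV
      · obtain ⟨d, hd, -⟩ := hglue ⟨y, hy⟩ t ((hU ⟨y, hy⟩).symm.trans ht.symm)
        have := (Scheme.homOfLE_apply inf_le_left d).symm.trans (congrArg Subtype.val hd)
        exact (congrArg (· ∈ V) this).mp d.2.2
    · intro hy
      exact ⟨ρ ⟨y, hy⟩, (hV ⟨y, hy⟩).symm⟩
  have hmem (y : Y) : y ∈ V ↔ π y ∈ j.opensRange := by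
    conv_lhs => rw [← hpre]
    rfl
  have hcase (y : Y) : y ∈ U ∨ y ∈ V := by
    by_cases hy : y = q
    · exact .inr (hy ▸ hqV)
    · exact .inl hy
  have hUb (u : U) : Function.Bijective (π.stalkMap u.1) := by
    have h₁ : U.ι ≫ π = 𝟙 (U : Scheme) ≫ i := by rw [hπU, Category.id_comp]
    have h₂ := bijective_stalkMap (𝟙 (U : Scheme)) u
    exact ⟨stalkMap_injective_of_comm h₁ u h₂.1, stalkMap_surjective_of_comm h₁ u h₂.2⟩
  refine ⟨X, π, j, hj, hπV, hpre, ?_, fun y ↦ ?_, fun y hy ↦ ?_⟩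
  · have hopen : IsOpenMap π := by
      intro N hN
      have : π '' N = i '' (Subtype.val ⁻¹' N) ∪ (fun v ↦ j (ρ v)) '' (Subtype.val ⁻¹' N) := by
        ext x
        constructor
        · rintro ⟨y, hy, rfl⟩
          rcases hcase y with h | h
          · exact .inl ⟨⟨y, h⟩, hy, (hU ⟨y, h⟩).symm⟩
          · exact .inr ⟨⟨y, h⟩, hy, (hV ⟨y, h⟩).symm⟩
        · rintro (⟨u, hu, rfl⟩ | ⟨v, hv, rfl⟩)
          · exact ⟨u.1, hu, hU u⟩
          · exact ⟨v.1, hv, hV v⟩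
      rw [this]
      exact (i.isOpenEmbedding.isOpenMap _ (hN.preimage continuous_subtype_val)).union
        ((j.isOpenEmbedding.comp hρ.isOpenEmbedding).isOpenMap _
          (hN.preimage continuous_subtype_val))
    refine ⟨π.continuous, hopen, fun y z h ↦ ?_, fun x ↦ ?_⟩
    · by_cases hy : y ∈ V
      · have hz : z ∈ V := (hmem z).mpr (h ▸ (hmem y).mp hy)
        have h' : j (ρ ⟨y, hy⟩) = j (ρ ⟨z, hz⟩) := (hV ⟨y, hy⟩).symm.trans (h.trans (hV ⟨z, hz⟩))
        exact congrArg Subtype.val (hρ.injective (j.isOpenEmbedding.injective h'))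
      · have hz : z ∉ V := fun hz ↦ hy ((hmem y).mpr (h ▸ (hmem z).mp hz))
        have hyU := (hcase y).resolve_right hy
        have hzU := (hcase z).resolve_right hz
        have h' : i ⟨y, hyU⟩ = i ⟨z, hzU⟩ := (hU ⟨y, hyU⟩).symm.trans (h.trans (hU ⟨z, hzU⟩))
        exact congrArg Subtype.val (i.isOpenEmbedding.injective h')
    · rcases hcov x with ⟨u, rfl⟩ | ⟨t, rfl⟩
      · exact ⟨u.1, hU u⟩
      · obtain ⟨v, rfl⟩ := hρ.surjective t
        exact ⟨v.1, hV v⟩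
  · rcases hcase y with h | h
    · exact (hUb ⟨y, h⟩).1
    · exact stalkMap_injective_of_comm hπV ⟨y, h⟩ (hinj _)
  · exact (hUb ⟨y, hy⟩).2

/-! ### Schemes homeomorphic to a curve -/

/-- The **Artin–Tate lemma** for ring homomorphisms. -/
theorem finiteType_of_finite_comp {R B A : Type*} [CommRing R] [CommRing B] [CommRing A]
    [IsNoetherianRing R] (f : R →+* B) (g : B →+* A) (hinj : Function.Injective g)
    (hg : g.Finite) (h : (g.comp f).FiniteType) : f.FiniteType := by
  algebraize [f, g, g.comp f]
  exact ⟨fg_of_fg_of_fg R B A Algebra.FiniteType.out Module.Finite.fg_top hinj⟩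

section Homeomorphic

open Limits

variable {X Y : Scheme.{0}} (π : Y ⟶ X)

theorem isIntegral_of_isHomeomorph [IsIntegral Y] (hπ : IsHomeomorph π)
    (hinj : ∀ y, Function.Injective (π.stalkMap y)) : IsIntegral X := by
  have : IrreducibleSpace X := by
    have h := (inferInstance : IrreducibleSpace Y)
    have := hπ.surjective.preirreducibleSpace hπ.continuous
    exact ⟨⟨π (genericPoint Y)⟩⟩
  have (x : X) : IsReduced (X.presheaf.stalk x) := by
    obtain ⟨y, rfl⟩ := hπ.surjective x
    exact isReduced_of_injective (π.stalkMap y).hom (hinj y)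
  have := isReduced_of_isReduced_stalk X
  exact isIntegral_of_irreducibleSpace_of_isReduced X

theorem isIso_morphismRestrict_of_bijective_stalkMap (hπ : IsHomeomorph π) (U : X.Opens)
    (h : ∀ y, π y ∈ U → Function.Bijective (π.stalkMap y)) : IsIso (π ∣_ U) := by
  have hstalk (y : ↑(π ⁻¹ᵁ U)) : IsIso ((π ∣_ U).stalkMap y) := by
    have h₁ : IsIso (π.stalkMap y.1) := (ConcreteCategory.isIso_iff_bijective _).mpr (h _ y.2)
    exact ((MorphismProperty.isomorphisms CommRingCat).arrow_mk_iso_iff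
      (morphismRestrictStalkMap π U y)).mpr h₁
  have hopen : IsOpenImmersion (π ∣_ U) := by
    refine .of_isIso_stalkMap _ ?_
    rw [morphismRestrict_base]
    exact hπ.isOpenEmbedding.restrictPreimage U.1
  have hsurj : Function.Surjective (π ∣_ U) := by
    rw [morphismRestrict_base]
    exact hπ.surjective.restrictPreimage U.1
  have : Epi (π ∣_ U).base := (TopCat.epi_iff_surjective _).mpr hsurj
  exact (isIso_iff_isOpenImmersion_and_epi_base _).mpr ⟨hopen, this⟩

/-- A morphism is integral if it is so over an open subscheme and an isomorphism elsewhere. -/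
theorem isIntegralHom_of_comm {V : Y.Opens} {T : Scheme.{0}} {ρ : ↑V ⟶ T} {j : T ⟶ X}
    [IsOpenImmersion j] [IsIntegralHom ρ] (h : V.ι ≫ π = ρ ≫ j) (hV : π ⁻¹ᵁ j.opensRange = V)
    (U : X.Opens) [hU : IsIso (π ∣_ U)] (hcov : U ⊔ j.opensRange = ⊤) : IsIntegralHom π := by
  let W : Bool → X.Opens := fun b ↦ cond b U j.opensRange
  have hW : iSup W = ⊤ := by
    rw [iSup_bool_eq]
    exact hcov
  have : IsZariskiLocalAtTarget @IsIntegralHom.{0} :=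
    @HasAffineProperty.instIsZariskiLocalAtTarget _ _ IsIntegralHom.hasAffineProperty
  rw [IsZariskiLocalAtTarget.iff_of_iSup_eq_top (P := @IsIntegralHom) W hW]
  rintro (_ | _)
  · have : π ∣_ j.opensRange = (Y.isoOfEq hV).hom ≫ ρ ≫ j.isoOpensRange.hom := by
      rw [← cancel_mono j.opensRange.ι, morphismRestrict_ι, Category.assoc, Category.assoc,
        Scheme.Hom.isoOpensRange_hom_ι, ← h, Scheme.isoOfEq_hom_ι_assoc]
    change IsIntegralHom (π ∣_ j.opensRange)
    rw [this]
    infer_instance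
  · change IsIntegralHom (π ∣_ U)
    infer_instance

variable {S : Scheme.{0}} (sX : X ⟶ S) (sY : Y ⟶ S) (hs : π ≫ sX = sY)

include hs

/-- The diagonal of X is the image of the diagonal of Y under π × π, because π is surjective; π × π
is universally closed because π is integral. -/
theorem isSeparated_of_surjective_of_isIntegralHom (hπ : Function.Surjective π) [IsIntegralHom π]
    [IsSeparated sY] : IsSeparated sX := by
  let m : pullback sY sY ⟶ pullback sX sX :=
    pullback.map sY sY sX sX π π (𝟙 S) (by simp [hs]) (by simp [hs])
  have hm : UniversallyClosed m :=
    MorphismProperty.pullbackMap (P := @UniversallyClosed) inferInstance inferInstance hs.symm hs.symm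
  have hd : π ≫ pullback.diagonal sX = pullback.diagonal sY ≫ m := by
    apply pullback.hom_ext
    · simp only [m, Category.assoc, pullback.lift_fst, pullback.diagonal_fst,
        pullback.diagonal_fst_assoc, Category.comp_id, pullback.map]
    · simp only [m, Category.assoc, pullback.lift_snd, pullback.diagonal_snd,
        pullback.diagonal_snd_assoc, Category.comp_id, pullback.map]
  have hclosed : IsClosed (Set.range (pullback.diagonal sX)) := by
    have : Set.range (pullback.diagonal sX) = Set.range (pullback.diagonal sY ≫ m) := by
      rw [← hd]
      exact (hπ.range_comp _).symm
    rw [this]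
    have h₁ : IsClosedMap (pullback.diagonal sY ≫ m) := Scheme.Hom.isClosedMap _
    exact h₁.isClosed_range
  exact ⟨IsClosedImmersion.of_isPreimmersion _ hclosed⟩

/-- Artin–Tate on affine open sets: the functions on X sit between a noetherian base and the
functions on Y, which are finite over them. -/
theorem locallyOfFiniteType_of_isFinite [IsLocallyNoetherian S] (hπ : Function.Surjective π)
    (hinj : ∀ y, Function.Injective (π.stalkMap y)) [IsFinite π] [LocallyOfFiniteType sY] :
    LocallyOfFiniteType sX := by
  refine ⟨fun {U} hU {V} hV e ↦ ?_⟩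
  have : IsNoetherianRing Γ(S, U) := IsLocallyNoetherian.component_noetherian ⟨U, hU⟩
  have e' : π ⁻¹ᵁ V ≤ sY ⁻¹ᵁ U := by
    rw [← hs]
    exact π.preimage_mono e
  have h₁ := sY.finiteType_appLE hU (hV.preimage π) e'
  have h₂ := π.finite_app V hV
  have h₃ := app_injective_of_stalkMap_injective π hπ hinj V
  have h₄ : (π.app V).hom.comp (sX.appLE U V e).hom = (sY.appLE U (π ⁻¹ᵁ V) e').hom := by
    subst hs
    rw [← CommRingCat.hom_comp, Scheme.Hom.app_eq_appLE, Scheme.Hom.appLE_comp_appLE]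
  exact finiteType_of_finite_comp _ _ h₃ h₂ (h₄ ▸ h₁)

end Homeomorphic

/-! ### Affine models with a prescribed local ring -/

section AffineModel

/-- With a - c in 𝔮, the power (a - c)^M already lies in B. -/
theorem isIntegral_of_pow_le {A : Type*} [CommRing A] (B : Subring A) (𝔮 : Ideal A) {M : ℕ}
    (hM0 : 0 < M) (hM : ∀ i ∈ 𝔮 ^ M, i ∈ B) (hres : ∀ a, ∃ c ∈ B, a - c ∈ 𝔮) :
    B.subtype.IsIntegral := by
  intro a
  obtain ⟨c, hc, h⟩ := hres a
  have h₁ : IsIntegral B (a - c) :=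
    .of_pow hM0 (isIntegral_algebraMap (R := B) (x := ⟨_, hM _ (Ideal.pow_mem_pow h M)⟩))
  have h₂ : IsIntegral B c := isIntegral_algebraMap (R := B) (x := ⟨c, hc⟩)
  have := h₁.add h₂
  rwa [sub_add_cancel] at this

variable {Z : Scheme.{0}}

/-- The morphism from `Z` to the spectrum of a subring of its ring of functions. -/
noncomputable def toSpecSubring (B : Subring Γ(Z, ⊤)) : Z ⟶ Spec (CommRingCat.of B) :=
  Z.toSpecΓ ≫ Spec.map (CommRingCat.ofHom B.subtype)

theorem toSpecSubring_appTop (B : Subring Γ(Z, ⊤)) : (toSpecSubring B).appTop =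
    (Scheme.ΓSpecIso (CommRingCat.of B)).hom ≫ CommRingCat.ofHom B.subtype := by
  rw [toSpecSubring, Scheme.Hom.comp_appTop, Scheme.toSpecΓ_appTop, Scheme.ΓSpecIso_naturality]

theorem mem_range_toSpecSubring_appTop (B : Subring Γ(Z, ⊤)) (a : Γ(Z, ⊤)) :
    a ∈ Set.range (toSpecSubring B).appTop ↔ a ∈ B := by
  rw [toSpecSubring_appTop]
  constructor
  · rintro ⟨x, rfl⟩
    exact ((Scheme.ΓSpecIso (CommRingCat.of B)).hom x).2
  · intro ha
    obtain ⟨x, hx⟩ := (ConcreteCategory.bijective_of_isIso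
      (Scheme.ΓSpecIso (CommRingCat.of B)).hom).2 ⟨a, ha⟩
    exact ⟨x, congrArg B.subtype hx⟩

theorem toSpecSubring_appTop_injective (B : Subring Γ(Z, ⊤)) :
    Function.Injective (toSpecSubring B).appTop := by
  rw [toSpecSubring_appTop]
  exact B.subtype_injective.comp (ConcreteCategory.bijective_of_isIso
    (Scheme.ΓSpecIso (CommRingCat.of B)).hom).1

/-- An integral affine scheme `Z` has a model whose local ring at `q` is a given subring `S` of the
local ring of `Z`. -/
theorem exists_affine_model [IsAffine Z] [IsIntegral Z] {q : Z} (hq : IsClosed {q})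
    (S : Subring (Z.presheaf.stalk q)) (hS : ∀ u v, u * v = 1 → u ∈ S → v ∈ S) {M : ℕ}
    (hM0 : 0 < M) (hM : ∀ z ∈ maximalIdeal (Z.presheaf.stalk q) ^ M, z ∈ S)
    (hres : ∀ a : Γ(Z, ⊤), ∃ c, Z.presheaf.germ ⊤ q trivial c ∈ S ∧
      a - c ∈ pointIdeal ⊤ q trivial) :
    ∃ (T : Scheme.{0}) (ρ : Z ⟶ T), IsAffine T ∧ IsIntegralHom ρ ∧ IsHomeomorph ρ ∧
      (∀ v, Function.Injective (ρ.stalkMap v)) ∧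
      (∀ v, v ≠ q → Function.Surjective (ρ.stalkMap v)) ∧ Set.range (ρ.stalkMap q) = S := by
  -- The model is Spec B, where B consists of the functions with germ in S; it contains the M-th
  -- power of the ideal of q.
  let B : Subring Γ(Z, ⊤) := S.comap (Z.presheaf.germ ⊤ q trivial).hom
  have hB : ∀ i ∈ pointIdeal ⊤ q trivial ^ M, i ∈ B := fun i hi ↦ hM _ (germ_mem_pow hi)
  have hint : B.subtype.IsIntegral := isIntegral_of_pow_le B _ hM0 hB hres
  let ρ := toSpecSubring B
  have hmax : (pointIdeal ⊤ q trivial).IsMaximal :=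
    isMaximal_pointIdeal (isAffineOpen_top Z) trivial hq
  have hV : IsAffineOpen (ρ ⁻¹ᵁ ⊤) := isAffineOpen_top Z
  have hT : IsAffineOpen (⊤ : (Spec (CommRingCat.of B)).Opens) := isAffineOpen_top _
  have hr : ∀ i ∈ pointIdeal (ρ ⁻¹ᵁ ⊤) q trivial ^ M, i ∈ Set.range (ρ.app ⊤) := fun i hi ↦
    (mem_range_toSpecSubring_appTop B i).mpr (hB i hi)
  refine ⟨_, ρ, inferInstance, ?_, ?_, fun v ↦ ?_, fun v hv ↦ ?_, ?_⟩
  · have : IsIntegralHom (Spec.map (CommRingCat.ofHom B.subtype)) :=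
      IsIntegralHom.SpecMap_iff.mpr hint
    change IsIntegralHom (Z.toSpecΓ ≫ _)
    infer_instance
  · have h₁ := isHomeomorph_comap_of_pow_le B.subtype B.subtype_injective hint
      (pointIdeal ⊤ q trivial) M (fun i hi ↦ ⟨⟨i, hB i hi⟩, rfl⟩)
    have h₂ : IsHomeomorph Z.toSpecΓ := (TopCat.isIso_iff_isHomeomorph Z.toSpecΓ.base).mp
      inferInstance
    exact h₁.comp h₂
  · exact stalkMap_injective_of_app_injective ρ hT (toSpecSubring_appTop_injective B) trivial
  · exact stalkMap_surjective_of_ne ρ hV trivial hq hr trivial hv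
  · exact range_stalkMap_eq_of_range_app_eq ρ hV trivial hq hr hT S hS
      (mem_range_toSpecSubring_appTop B)

end AffineModel

/-! ### The curve with a prescribed local ring -/

section Construction

theorem mem_maximalIdeal_pow_of_map {A B : Type*} [CommRing A] [CommRing B] [IsLocalRing A]
    [IsLocalRing B] (e : A →+* B) (he : Function.Bijective e) {M : ℕ} {z : A}
    (hz : e z ∈ maximalIdeal B ^ M) : z ∈ maximalIdeal A ^ M := by
  let e' := RingEquiv.ofBijective e he
  have hle : maximalIdeal B ≤ (maximalIdeal A).comap (e'.symm : B →+* A) := by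
    intro x hx
    rw [Ideal.mem_comap, mem_maximalIdeal, mem_nonunits_iff]
    intro hu
    refine (mem_nonunits_iff.mp ((mem_maximalIdeal x).mp hx)) ?_
    have := hu.map (e' : A →+* B)
    simpa using this
  have h := Ideal.le_comap_pow (e'.symm : B →+* A) M (Ideal.pow_right_mono hle M hz)
  rw [Ideal.mem_comap] at h
  have hez : (e'.symm : B →+* A) (e z) = z := e'.symm_apply_apply z
  rwa [hez] at h

variable {Y : Scheme.{0}} (sY : Y ⟶ SpecC)

/-- A constant as a global function. -/
noncomputable def constantSection : ℂ →+* Γ(Y, ⊤) :=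
  ((Scheme.ΓSpecIso (CommRingCat.of ℂ)).inv ≫ sY.appTop).hom

theorem stalkMap_structureMap {X : Scheme.{0}} (π : X ⟶ Y) (x : X) (c : ℂ) :
    π.stalkMap x (structureMap sY (π x) c) = structureMap (π ≫ sY) x c :=
  (localRingMap π rfl x).commutes c

/-- A ring homomorphism `ℂ → Γ(X, ⊤)` compatible with `sY` gives a morphism over `ℂ`. -/
theorem exists_comp_eq_of_constantSection {X : Scheme.{0}} (π : Y ⟶ X) (θ : ℂ →+* Γ(X, ⊤))
    (hθ : ∀ c, π.appTop (θ c) = constantSection sY c) : ∃ sX : X ⟶ SpecC, π ≫ sX = sY := by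
  refine ⟨X.toSpecΓ ≫ Spec.map (CommRingCat.ofHom θ), ext_of_isAffine ?_⟩
  rw [Scheme.Hom.comp_appTop, Scheme.Hom.comp_appTop, Scheme.toSpecΓ_appTop,
    Scheme.ΓSpecIso_naturality, ← cancel_epi (Scheme.ΓSpecIso (CommRingCat.of ℂ)).inv,
    Category.assoc, Iso.inv_hom_id_assoc]
  ext c
  exact hθ c

theorem isCurve_of_isHomeomorph {X : Scheme.{0}} (π : Y ⟶ X) (sX : X ⟶ SpecC)
    (hs : π ≫ sX = sY) (hY : IsCurve sY) (hπ : IsHomeomorph π)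
    (hinj : ∀ y, Function.Injective (π.stalkMap y)) [IsIntegralHom π] : IsCurve sX := by
  have := hY.isIntegral
  have := hY.isSeparated
  have := hY.locallyOfFiniteType
  have : LocallyOfFiniteType π :=
    haveI : LocallyOfFiniteType (π ≫ sX) := by rwa [hs]
    locallyOfFiniteType_of_comp π sX
  have : IsFinite π :=
    (IsFinite.iff_isIntegralHom_and_locallyOfFiniteType _).mpr ⟨inferInstance, inferInstance⟩
  refine ⟨isIntegral_of_isHomeomorph π hπ hinj,
    isSeparated_of_surjective_of_isIntegralHom π sX sY hs hπ.surjective,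
    locallyOfFiniteType_of_isFinite π sX sY hs hπ.surjective hinj, ?_, ?_⟩
  · have : CompactSpace Y := (quasiCompact_iff_compactSpace sY).mp hY.quasiCompact
    have : CompactSpace X := ⟨hπ.surjective.range_eq ▸ isCompact_range hπ.continuous⟩
    exact (quasiCompact_iff_compactSpace sX).mpr this
  · rw [← IsHomeomorph.topologicalKrullDim_eq _ hπ, hY.dim_eq_one]

/-- An affine open neighbourhood of `q` has a model whose local ring at `q` is a suitable
subring of the local ring of `Y`. -/
theorem exists_affine_model_of_isAffineOpen (hY : IsCurve sY) {q : Y} (hq : IsClosed {q})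
    (S : Subring (Y.presheaf.stalk q)) (hS : ∀ u v, u * v = 1 → u ∈ S → v ∈ S)
    (hconst : ∀ c, structureMap sY q c ∈ S) {M : ℕ} (hM0 : 0 < M)
    (hM : ∀ z ∈ maximalIdeal (Y.presheaf.stalk q) ^ M, z ∈ S)
    {V : Y.Opens} (hV : IsAffineOpen V) (hqV : q ∈ V) :
    ∃ (T : Scheme.{0}) (ρ : (V : Scheme) ⟶ T), IsAffine T ∧ IsIntegralHom ρ ∧ IsHomeomorph ρ ∧
      (∀ v, Function.Injective (ρ.stalkMap v)) ∧
      (∀ v : V, v.1 ≠ q → Function.Surjective (ρ.stalkMap v)) ∧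
      ∀ z, V.ι.stalkMap ⟨q, hqV⟩ z ∈ Set.range (ρ.stalkMap ⟨q, hqV⟩) ↔ z ∈ S := by
  have := hY.isIntegral
  let q' : (V : Scheme) := ⟨q, hqV⟩
  have hq' : IsClosed {q'} := by
    have := hq.preimage (continuous_subtype_val (p := (· ∈ V)))
    convert! this
    ext v
    exact Subtype.ext_iff
  let e : Y.presheaf.stalk q →+* (V : Scheme).presheaf.stalk q' := (V.ι.stalkMap q').hom
  have he : Function.Bijective e := bijective_stalkMap V.ι q'
  have : IsAffine (V : Scheme) := hV
  have : Nonempty (V : Scheme) := ⟨q'⟩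
  have : IsIntegral (V : Scheme) := isIntegral_of_isOpenImmersion V.ι
  obtain ⟨T, ρ, hT, hρi, hρ, hρinj, hρsurj, hρS⟩ := exists_affine_model hq' (S.map e)
    (by
      rintro _ v huv ⟨u, hu, rfl⟩
      obtain ⟨v, rfl⟩ := he.2 v
      refine ⟨v, hS u v (he.1 ?_) hu, rfl⟩
      rw [map_mul, huv, map_one]) hM0
    (by
      intro z hz
      obtain ⟨z, rfl⟩ := he.2 z
      exact ⟨z, hM z (mem_maximalIdeal_pow_of_map e he hz), rfl⟩)
    (by
      intro a
      obtain ⟨z, hz⟩ := he.2 ((V : Scheme).presheaf.germ ⊤ q' trivial a)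
      -- Constants represent all residue classes at q and lie in S, which gives integrality over the
      -- subring.
      obtain ⟨c, hc⟩ := exists_sub_structureMap_mem sY hY hq z
      have hec : e (structureMap sY q c) =
          (V : Scheme).presheaf.germ ⊤ q' trivial (constantSection (V.ι ≫ sY) c) :=
        stalkMap_structureMap sY V.ι q' c
      refine ⟨constantSection (V.ι ≫ sY) c, ⟨_, hconst c, hec⟩, mem_pointIdeal.mpr ?_⟩
      rw [map_sub, ← hz, ← hec, ← map_sub]
      intro hu
      exact (mem_nonunits_iff.mp ((mem_maximalIdeal _).mp hc))
        (isUnit_of_map_unit (V.ι.stalkMap q').hom _ hu))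
  refine ⟨T, ρ, hT, hρi, hρ, hρinj, fun v hv ↦ hρsurj v fun h ↦ hv (congrArg Subtype.val h),
    fun z ↦ ?_⟩
  rw [hρS]
  exact he.1.mem_set_image

/-- Every suitable subring of the local ring of a curve `Y` at a smooth point is the local ring of a
curve that is isomorphic to `Y` elsewhere. -/
theorem exists_curve_of_subring (hY : IsCurve sY) {q : Y} (hq : IsClosed {q})
    (S : Subring (Y.presheaf.stalk q)) (hS : ∀ u v, u * v = 1 → u ∈ S → v ∈ S)
    (hconst : ∀ c, structureMap sY q c ∈ S) {M : ℕ} (hM0 : 0 < M)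
    (hM : ∀ z ∈ maximalIdeal (Y.presheaf.stalk q) ^ M, z ∈ S) :
    ∃ (X : Scheme.{0}) (sX : X ⟶ SpecC) (π : Y ⟶ X), IsCurve sX ∧ π ≫ sX = sY ∧
      IsHomeomorph π ∧ IsIntegralHom π ∧ (∀ y, Function.Injective (π.stalkMap y)) ∧
      (∀ y, y ≠ q → Function.Surjective (π.stalkMap y)) ∧ Set.range (π.stalkMap q) = S := by
  have := hY.isIntegral
  obtain ⟨V, hV, hqV, -⟩ := exists_isAffineOpen_mem_and_subset (X := Y) (x := q) (U := ⊤) trivial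
  obtain ⟨T, ρ, hT, hρi, hρ, hρinj, hρsurj, hρS⟩ :=
    exists_affine_model_of_isAffineOpen sY hY hq S hS hconst hM0 hM hV hqV
  obtain ⟨X, π, j, hj, hcomm, hpre, hπ, hinj, hsurj⟩ := exists_pinch hqV hq ρ hρ hρinj hρsurj
  have hrange : Set.range (π.stalkMap q) = S := by
    ext z
    exact (mem_range_stalkMap_iff_of_comm hcomm ⟨q, hqV⟩ z).trans (hρS z)
  have hp : IsClosed {π q} := by
    rw [← Set.image_singleton]
    exact hπ.isClosedMap _ hq
  let U : X.Opens := ⟨{π q}ᶜ, hp.isOpen_compl⟩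
  have hU : IsIso (π ∣_ U) := isIso_morphismRestrict_of_bijective_stalkMap π hπ U fun y hy ↦
    ⟨hinj y, hsurj y fun h ↦ hy (congrArg π h)⟩
  have hcov : U ⊔ j.opensRange = ⊤ := by
    rw [eq_top_iff]
    intro x _
    by_cases hx : x = π q
    · right
      have hqj : q ∈ π ⁻¹ᵁ j.opensRange := hpre ▸ hqV
      exact hx ▸ hqj
    · exact .inl hx
  have hint : IsIntegralHom π := isIntegralHom_of_comm π hcomm hpre U hcov
  -- Constant functions on Y descend to X, as their germs at q lie in S and the stalk maps elsewhere
  -- are surjective; this yields the structure morphism of X.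
  obtain ⟨θ, hθ⟩ := exists_ringHom_comp_eq π.appTop.hom
    (app_injective_of_stalkMap_injective π hπ.surjective hinj ⊤) (constantSection sY) (by
      intro c
      refine mem_range_app_of_germ_mem_range π hπ hinj ⊤ _ fun y hy ↦ ?_
      by_cases hyq : y = q
      · subst hyq
        rw [hrange]
        exact hconst c
      · exact hsurj y hyq _)
  obtain ⟨sX, hs⟩ := exists_comp_eq_of_constantSection sY π θ hθ
  exact ⟨X, sX, π, isCurve_of_isHomeomorph sY π sX hs hY hπ hinj, hs, hπ, hint, hinj, hsurj, hrange⟩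

end Construction

/-! ### Regular local rings of curves -/

section Regular

/-- Regularity and dimension at most one bound the cotangent space by one, so S is a Dedekind
domain. -/
theorem isIntegrallyClosed_of_isRegularLocalRing (S : Type*) [CommRing S] [IsDomain S]
    [h : IsRegularLocalRing S] [Ring.KrullDimLE 1 S] : IsIntegrallyClosed S := by
  have h₁ := (IsRegularLocalRing.iff_finrank_cotangentSpace S).mp h
  have h₂ : ringKrullDim S ≤ 1 := by
    exact_mod_cast Ring.krullDimLE_iff.mp (inferInstance : Ring.KrullDimLE 1 S)
  rw [← h₁] at h₂
  have h₃ : Module.finrank (ResidueField S) (CotangentSpace S) ≤ 1 := by exact_mod_cast h₂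
  have h₄ : IsDedekindDomain S :=
    ((tfae_of_isNoetherianRing_of_isLocalRing_of_isDomain S).out 5 2).mp h₃
  infer_instance

/-- The conductor element t gives x / y = (t x) / (t y), so B and O have the same fraction field,
and O is integral over B. -/
theorem subring_eq_top_of_isIntegrallyClosed {O : Type*} [CommRing O] [IsDomain O] (B : Subring O)
    [IsIntegrallyClosed B] (hint : B.subtype.IsIntegral) {t : O} (ht : t ≠ 0)
    (htB : ∀ a, t * a ∈ B) : B = ⊤ := by
  let K := FractionRing O
  have hinj : Function.Injective (algebraMap B K) :=
    (IsFractionRing.injective O K).comp B.subtype_injective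
  have : FaithfulSMul B K := (faithfulSMul_iff_algebraMap_injective B K).mpr hinj
  have ht' : algebraMap O K t ≠ 0 := (map_ne_zero_iff _ (IsFractionRing.injective O K)).mpr ht
  have : IsFractionRing B K := IsFractionRing.of_field B K fun z ↦ by
    obtain ⟨x, y, -, rfl⟩ := IsFractionRing.div_surjective O z
    refine ⟨⟨_, htB x⟩, ⟨_, htB y⟩, ?_⟩
    change _ = algebraMap O K (t * x) / algebraMap O K (t * y)
    rw [map_mul, map_mul, mul_div_mul_left _ _ ht']
  rw [eq_top_iff]
  intro a _
  have h₁ : IsIntegral B a := hint a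
  have h₂ : IsIntegral B (algebraMap O K a) := h₁.algebraMap
  obtain ⟨b, hb⟩ := IsIntegrallyClosed.isIntegral_iff.mp h₂
  have : (b : O) = a := IsFractionRing.injective O K hb
  exact this ▸ b.2

/-- A proper subring of a discrete valuation ring that contains a power of the maximal ideal is not
regular of dimension at most one. -/
theorem surjective_of_isRegularLocalRing {S O : Type*} [CommRing S] [CommRing O] [IsDomain S]
    [IsDomain O] [IsLocalRing O] [IsRegularLocalRing S] [Ring.KrullDimLE 1 S] (f : S →+* O)
    (hf : Function.Injective f) {M : ℕ} (hM0 : 0 < M)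
    (hM : ∀ a ∈ maximalIdeal O ^ M, a ∈ Set.range f) (hO : ¬ IsField O)
    (hres : ∀ a, ∃ c ∈ Set.range f, a - c ∈ maximalIdeal O) : Function.Surjective f := by
  have := isIntegrallyClosed_of_isRegularLocalRing S
  have hc : IsIntegrallyClosed f.range :=
    .of_equiv (RingEquiv.ofBijective f.rangeRestrict
      ⟨fun a b h ↦ hf (congrArg Subtype.val h), f.rangeRestrict_surjective⟩)
  have hint := isIntegral_of_pow_le f.range (maximalIdeal O) hM0 hM hres
  obtain ⟨t, ht, ht0⟩ := Submodule.exists_mem_ne_zero_of_ne_bot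
    (pow_ne_zero M (fun h ↦ hO (isField_iff_maximalIdeal_eq.mpr h)) : maximalIdeal O ^ M ≠ ⊥)
  have h := subring_eq_top_of_isIntegrallyClosed f.range hint ht0
    fun a ↦ hM _ (Ideal.mul_mem_right _ _ ht)
  exact RingHom.range_eq_top.mp h

end Regular

/-! ### Glued curves and complete subalgebras -/

section Correspondence

variable {Y : Scheme.{0}} {sY : Y ⟶ SpecC} {q : Y} {Γ : AddSubmonoid ℕ}

theorem isNoetherianRing_localRingAt (hY : IsCurve sY) (y : Y) :
    IsNoetherianRing (LocalRingAt sY y) :=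
  haveI := isLocallyNoetherian_of_isCurve sY hY
  inferInstanceAs (IsNoetherianRing (Y.presheaf.stalk y))

theorem completeLocalSubalgebra_eq_map {X : Scheme.{0}} {sX : X ⟶ SpecC} (π : Y ⟶ X)
    (hπ : π ≫ sX = sY) (ι ι' : CompleteLocalRing sY q ≃ₐ[ℂ] ℂ⟦X⟧) :
    completeLocalSubalgebra π hπ q ι =
      (completeLocalSubalgebra π hπ q ι').map (ι'.symm.trans ι).toAlgHom := by
  ext g
  constructor
  · rintro ⟨x, rfl⟩
    refine ⟨_, ⟨x, rfl⟩, ?_⟩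
    change ι (ι'.symm (ι' _)) = ι _
    rw [ι'.symm_apply_apply]
  · rintro ⟨_, ⟨x, rfl⟩, rfl⟩
    refine ⟨x, ?_⟩
    change ι _ = ι (ι'.symm (ι' _))
    rw [ι'.symm_apply_apply]

/-- The germs at `q` whose expansion lies in `R`. -/
noncomputable def stalkSubring (ι : CompleteLocalRing sY q ≃ₐ[ℂ] ℂ⟦X⟧) (R : Subalgebra ℂ ℂ⟦X⟧) :
    Subring (Y.presheaf.stalk q) :=
  R.toSubring.comap (expand ι).toRingHom

section

variable (hY : IsCurve sY) {X : Scheme.{0}} {sX : X ⟶ SpecC} (π : Y ⟶ X) (hπ : π ≫ sX = sY)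
  (ι : CompleteLocalRing sY q ≃ₐ[ℂ] ℂ⟦X⟧) (hinj : Function.Injective (π.stalkMap q)) {M : ℕ}
  (hM0 : 0 < M) (hM : ∀ a ∈ maximalIdeal (Y.presheaf.stalk q) ^ M, a ∈ Set.range (π.stalkMap q))

include hY hinj hM0 hM

theorem stalkSubring_completeLocalSubalgebra :
    (stalkSubring ι (completeLocalSubalgebra π hπ q ι) : Set (Y.presheaf.stalk q)) =
      Set.range (π.stalkMap q) := by
  have := isNoetherianRing_localRingAt hY q
  ext a
  exact expand_mem_range_iff (f := localRingMap π hπ q) ι hinj hM0 hM a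

/-- R is both open and closed, so it consists of the limits of the expansions lying in it. By
`mem_range_iff_forall_exists` the same limits make up the completed image. -/
theorem completeLocalSubalgebra_eq_of_range {R : Subalgebra ℂ ℂ⟦X⟧} {N : ℕ}
    (hR : ∀ g, PowerSeries.X ^ N ∣ g → g ∈ R)
    (hr : Set.range (π.stalkMap q) = stalkSubring ι R) :
    completeLocalSubalgebra π hπ q ι = R := by
  have := isNoetherianRing_localRingAt hY q
  have hr' : Set.range (localRingMap π hπ q) = {a | expand ι a ∈ R} := hr
  ext g
  refine (mem_range_iff_forall_exists (f := localRingMap π hπ q) ι hinj hM0 hM g).trans ?_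
  rw [hr']
  constructor
  · intro h
    obtain ⟨a, ha, hag⟩ := h N
    have := R.add_mem (hR _ hag) ha
    rwa [sub_add_cancel] at this
  · intro hg n
    obtain ⟨a, ha⟩ := exists_X_pow_dvd_sub_expand ι (max n N) g
    refine ⟨a, ?_, (pow_dvd_pow _ (le_max_left n N)).trans ha⟩
    have := R.sub_mem hg (hR _ ((pow_dvd_pow _ (le_max_right n N)).trans ha))
    rw [sub_sub_cancel] at this
    exact this

theorem completeLocalSubalgebra_isComplete :
    IsCompleteSubalgebra (completeLocalSubalgebra π hπ q ι) := by
  have := isNoetherianRing_localRingAt hY q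
  exact isCompleteSubalgebra_of_X_pow_dvd fun g hg ↦
    mem_range_of_X_pow_dvd (f := localRingMap π hπ q) ι hinj hM0 hM hg

end

namespace GluedCurve

variable (hY : IsCurve sY) (hq : IsClosed {q}) (G : GluedCurve sY q Γ)
  (ι : CompleteLocalRing sY q ≃ₐ[ℂ] ℂ⟦X⟧)

theorem orderSet_completeLocalSubalgebra :
    orderSet (completeLocalSubalgebra G.π G.w q ι) = (Γ : Set ℕ) := by
  obtain ⟨ι', h⟩ := G.semigroup
  rw [completeLocalSubalgebra_eq_map G.π G.w ι ι', orderSet_map_algEquiv, h]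

include hY hq

theorem completionMap_injective : Function.Injective (completionMap (localRingMap G.π G.w q)) := by
  obtain ⟨M, hM0, hM⟩ := G.exists_pow_le_range_stalkMap hY hq
  have := isNoetherianRing_localRingAt hY q
  exact CurveGluing.completionMap_injective (f := localRingMap G.π G.w q)
    (G.stalkMap_injective hY q) hM0 hM

/-- The complete subalgebra attached to a glued curve. -/
noncomputable def toCompleteSubalgebra : CompleteSubalgebras Γ :=
  ⟨completeLocalSubalgebra G.π G.w q ι, by
    obtain ⟨M, hM0, hM⟩ := G.exists_pow_le_range_stalkMap hY hq
    exact completeLocalSubalgebra_isComplete hY G.π G.w ι (G.stalkMap_injective hY q) hM0 hM,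
    G.orderSet_completeLocalSubalgebra ι⟩

theorem range_stalkMap_eq : Set.range (G.π.stalkMap q) =
    stalkSubring ι (completeLocalSubalgebra G.π G.w q ι) := by
  obtain ⟨M, hM0, hM⟩ := G.exists_pow_le_range_stalkMap hY hq
  exact (stalkSubring_completeLocalSubalgebra hY G.π G.w ι (G.stalkMap_injective hY q) hM0 hM).symm

omit hY hq in
theorem range_stalkMap_eq_of_equiv {G H : GluedCurve sY q Γ} (h : G ≈ H) :
    Set.range (G.π.stalkMap q) = Set.range (H.π.stalkMap q) := by
  obtain ⟨φ, -, h⟩ := h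
  have h₁ := range_stalkMap_comp G.π φ.hom q
  rw [(bijective_stalkMap φ.hom (G.π q)).2.range_eq, Set.image_univ] at h₁
  rw [← h₁, h]

/-- An isomorphism under Y preserves the range of the stalk map at q, and this range determines the
complete subalgebra. -/
theorem completeLocalSubalgebra_eq_of_equiv {G H : GluedCurve sY q Γ} (h : G ≈ H) :
    completeLocalSubalgebra G.π G.w q ι = completeLocalSubalgebra H.π H.w q ι := by
  have := isNoetherianRing_localRingAt hY q
  obtain ⟨M, hM0, hM⟩ := G.exists_pow_le_range_stalkMap hY hq
  obtain ⟨N, hN0, hN⟩ := H.exists_pow_le_range_stalkMap hY hq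
  refine completeLocalSubalgebra_eq_of_range hY G.π G.w ι (G.stalkMap_injective hY q) hM0 hM
    (N := N) (fun g hg ↦ mem_range_of_X_pow_dvd (f := localRingMap H.π H.w q) ι
      (H.stalkMap_injective hY q) hN0 hN hg) ?_
  rw [range_stalkMap_eq_of_equiv h, H.range_stalkMap_eq hY hq ι]

/-- The complete subalgebra recovers the range of the stalk map at q, and elsewhere the stalk maps
are surjective; so all ranges agree. Compatibility with the structure morphisms may be tested after
composing with π. -/
theorem equiv_of_completeLocalSubalgebra_eq {G H : GluedCurve sY q Γ}
    (h : completeLocalSubalgebra G.π G.w q ι = completeLocalSubalgebra H.π H.w q ι) : G ≈ H := by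
  obtain ⟨φ, hφ⟩ := exists_iso_of_range_stalkMap_eq G.π H.π G.isHomeomorph_π
    (G.stalkMap_injective hY) H.isHomeomorph_π (H.stalkMap_injective hY) (by
      intro y
      by_cases hy : y = q
      · subst hy
        rw [G.range_stalkMap_eq hY hq ι, H.range_stalkMap_eq hY hq ι, h]
      · rw [(G.stalkMap_surjective hy).range_eq, (H.stalkMap_surjective hy).range_eq])
  refine ⟨φ, ?_, hφ⟩
  apply hom_ext_of_stalkMap_injective G.π G.isHomeomorph_π.surjective (G.stalkMap_injective hY)
  rw [reassoc_of% hφ, H.w, G.w]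

end GluedCurve

end Correspondence

/-! ### Existence and gluing -/

section Existence

variable {Y : Scheme.{0}} {sY : Y ⟶ SpecC} {q : Y} {Γ : AddSubmonoid ℕ}

theorem inv_mem_stalkSubring {ι : CompleteLocalRing sY q ≃ₐ[ℂ] ℂ⟦X⟧} {R : Subalgebra ℂ ℂ⟦X⟧}
    {M : ℕ} (hR : ∀ g, PowerSeries.X ^ M ∣ g → g ∈ R) (u v : Y.presheaf.stalk q)
    (huv : u * v = 1) (hu : u ∈ stalkSubring ι R) : v ∈ stalkSubring ι R := by
  refine inv_mem_of_X_pow_dvd hR (u := expand ι (u : LocalRingAt sY q)) hu ?_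
  have h := congrArg (expand ι) (show (u * v : LocalRingAt sY q) = 1 from huv)
  exact (map_mul (expand ι) (u : LocalRingAt sY q) (v : LocalRingAt sY q)).symm.trans
    (h.trans (map_one (expand ι)))

theorem structureMap_mem_stalkSubring (ι : CompleteLocalRing sY q ≃ₐ[ℂ] ℂ⟦X⟧)
    (R : Subalgebra ℂ ℂ⟦X⟧) (c : ℂ) : structureMap sY q c ∈ stalkSubring ι R := by
  have h : expand ι (algebraMap ℂ (LocalRingAt sY q) c) ∈ R := by
    rw [AlgHom.commutes]
    exact R.algebraMap_mem c
  exact h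

theorem mem_stalkSubring_of_mem_pow (hY : IsCurve sY) (ι : CompleteLocalRing sY q ≃ₐ[ℂ] ℂ⟦X⟧)
    {R : Subalgebra ℂ ℂ⟦X⟧} {M : ℕ} (hR : ∀ g, PowerSeries.X ^ M ∣ g → g ∈ R)
    (z : Y.presheaf.stalk q) (hz : z ∈ maximalIdeal (Y.presheaf.stalk q) ^ M) :
    z ∈ stalkSubring ι R := by
  have := isNoetherianRing_localRingAt hY q
  exact hR _ ((X_pow_dvd_expand_iff ι M (z : LocalRingAt sY q)).mpr hz)

theorem eq_top_of_stalkSubring_eq_univ (hY : IsCurve sY)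
    (ι : CompleteLocalRing sY q ≃ₐ[ℂ] ℂ⟦X⟧) {R : Subalgebra ℂ ℂ⟦X⟧} {M : ℕ}
    (hR : ∀ g, PowerSeries.X ^ M ∣ g → g ∈ R) (h : ∀ a, a ∈ stalkSubring ι R) : R = ⊤ := by
  have := isNoetherianRing_localRingAt hY q
  rw [eq_top_iff]
  intro g _
  obtain ⟨a, ha⟩ := exists_X_pow_dvd_sub_expand ι M g
  have ha' : expand ι a ∈ R := h a
  have := R.add_mem (hR _ ha) ha'
  rwa [sub_add_cancel] at this

theorem orderSet_top : orderSet ⊤ = Set.univ := by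
  refine Set.eq_univ_of_forall fun n ↦ ?_
  exact ⟨PowerSeries.X ^ n, trivial, pow_ne_zero n PowerSeries.X_ne_zero,
    PowerSeries.order_X_pow n⟩

/-- Every complete subalgebra with semigroup `Γ` comes from a glued curve. -/
theorem exists_gluedCurve (hY : IsCurve sY) [Smooth sY] (hq : IsClosed {q})
    (hΓ : ((Γ : Set ℕ)ᶜ).Finite) (hΓ' : Γ ≠ ⊤) (ι : CompleteLocalRing sY q ≃ₐ[ℂ] ℂ⟦X⟧)
    (R : CompleteSubalgebras Γ) :
    ∃ G : GluedCurve sY q Γ, completeLocalSubalgebra G.π G.w q ι = R.1 := by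
  obtain ⟨M, hM⟩ := exists_conductor R.2.1 (by rw [R.2.2]; exact hΓ)
  -- The exponent is made positive, so that elements of this power of the maximal ideal are
  -- non-units.
  replace hM : ∀ g, PowerSeries.X ^ (M + 1) ∣ g → g ∈ R.1 := fun g hg ↦
    hM g ((pow_dvd_pow _ M.le_succ).trans hg)
  have hmem := mem_stalkSubring_of_mem_pow hY ι hM
  obtain ⟨X, sX, π, hX, hs, hπ, hint, hinj, hsurj, hr⟩ := exists_curve_of_subring sY hY hq
    (stalkSubring ι R.1) (inv_mem_stalkSubring hM) (structureMap_mem_stalkSubring ι R.1)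
    M.succ_pos hmem
  have hp : IsClosed {π q} := by
    rw [← Set.image_singleton]
    exact hπ.isClosedMap _ hq
  have hiso : IsIso (π ∣_ (⟨{π q}ᶜ, hp.isOpen_compl⟩ : X.Opens)) :=
    isIso_morphismRestrict_of_bijective_stalkMap π hπ _ fun y hy ↦
      ⟨hinj y, hsurj y fun h ↦ hy (congrArg π h)⟩
  have hcond : ∀ a ∈ maximalIdeal (Y.presheaf.stalk q) ^ (M + 1), a ∈ Set.range (π.stalkMap q) := by
    rw [hr]
    exact hmem
  have heq : completeLocalSubalgebra π hs q ι = R.1 :=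
    completeLocalSubalgebra_eq_of_range hY π hs ι (hinj q) M.succ_pos hcond hM hr
  have := hY.isIntegral
  refine ⟨{
    X := X
    s := sX
    isCurve := hX
    π := π
    w := hs
    isClosed_point := hp
    preimage_point := ?_
    isNormalisation := ⟨hint, isIntegrallyClosed_stalk sY, ⟨⟨{π q}ᶜ, hp.isOpen_compl⟩, ?_, hiso⟩⟩
    singular := ?_
    semigroup := ⟨ι, heq ▸ R.2.2⟩
    isIso_away := hiso }, heq⟩
  · rw [← Set.image_singleton, Set.preimage_image_eq _ hπ.injective]
  · exact exists_ne_of_isCurve sX hX (π q)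
  -- Regularity would make the stalk map at q surjective, so that R is all of ℂ⟦X⟧ and Γ is ℕ.
  · intro hreg
    have := hX.isIntegral
    have := krullDimLE_one_stalk sX hX (π q)
    have hsur := surjective_of_isRegularLocalRing (π.stalkMap q).hom (hinj q) M.succ_pos hcond
      (not_isField_stalk sY hY hq) (by
        intro a
        obtain ⟨c, hc⟩ := exists_sub_structureMap_mem sY hY hq a
        have hc' : structureMap sY q c ∈ Set.range (π.stalkMap q) := by
          rw [hr]
          exact structureMap_mem_stalkSubring ι R.1 c
        exact ⟨_, hc', hc⟩)
    have htop : R.1 = ⊤ := eq_top_of_stalkSubring_eq_univ hY ι hM fun a ↦ by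
      rw [← SetLike.mem_coe, ← hr]
      exact hsur a
    refine hΓ' (SetLike.coe_injective ?_)
    rw [← R.2.2, htop, orderSet_top]
    rfl

/-- A glued curve is glued along its complete local ring. -/
theorem GluedCurve.isGluingAlong (hY : IsCurve sY) (hq : IsClosed {q}) (G : GluedCurve sY q Γ)
    (ι : CompleteLocalRing sY q ≃ₐ[ℂ] ℂ⟦X⟧) :
    G.IsGluingAlong ι (completeLocalSubalgebra G.π G.w q ι) := by
  intro V hV hqV
  have hπ := G.isHomeomorph_π
  have hinj := G.stalkMap_injective hY
  -- Every open V is a full preimage, because π is a homeomorphism.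
  obtain ⟨W, rfl⟩ : ∃ W : G.X.Opens, G.π ⁻¹ᵁ W = V :=
    ⟨⟨G.π '' V, hπ.isOpenMap _ V.2⟩, Opens.ext (Set.preimage_image_eq _ hπ.injective)⟩
  obtain ⟨M, hM0, hM⟩ := G.exists_pow_le_range_stalkMap hY hq
  have hr := G.range_stalkMap_eq hY hq ι
  have := isNoetherianRing_localRingAt hY q
  have hX (g : ℂ⟦X⟧) (hg : PowerSeries.X ^ M ∣ g) : g ∈ completeLocalSubalgebra G.π G.w q ι :=
    mem_range_of_X_pow_dvd (f := localRingMap G.π G.w q) ι (hinj q) hM0 hM hg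
  obtain ⟨T, ρ, hT, -, hρ, hρinj, hρsurj, hρS⟩ := exists_affine_model_of_isAffineOpen sY hY hq
    (stalkSubring ι (completeLocalSubalgebra G.π G.w q ι)) (inv_mem_stalkSubring hX)
    (structureMap_mem_stalkSubring ι _) hM0 (mem_stalkSubring_of_mem_pow hY ι hX) hV hqV
  have hcomm : (G.π ⁻¹ᵁ W).ι ≫ G.π = G.π ∣_ W ≫ W.ι := (morphismRestrict_ι G.π W).symm
  have hhomeo : IsHomeomorph (G.π ∣_ W) := by
    have h₁ := hπ.isOpenEmbedding.restrictPreimage W.1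
    have h₂ := hπ.surjective.restrictPreimage W.1
    rw [← morphismRestrict_base] at h₁ h₂
    exact ⟨h₁.continuous, h₁.isOpenMap, h₁.injective, h₂⟩
  -- The affine model of V built from S and the restriction of π over W have the same stalks, so W
  -- is isomorphic to the affine scheme T.
  obtain ⟨φ, -⟩ := exists_iso_of_range_stalkMap_eq ρ (G.π ∣_ W) hρ hρinj hhomeo
    (fun v ↦ (stalkMap_injective_iff_of_comm hcomm v).mp (hinj _)) (by
      intro v
      ext z
      obtain ⟨z, rfl⟩ := (bijective_stalkMap (G.π ⁻¹ᵁ W).ι v).2 z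
      have h := mem_range_stalkMap_iff_of_comm hcomm v z
      refine Iff.trans ?_ h
      by_cases hv : v.1 = q
      · obtain ⟨v, hvV⟩ := v
        obtain rfl : v = q := hv
        refine (hρS z).trans ?_
        exact (Set.ext_iff.mp hr z).symm
      · exact iff_of_true (hρsurj v hv _) (G.stalkMap_surjective hv _))
  have hWaff : IsAffine (W : Scheme) := .of_isIso φ.inv
  refine ⟨W, hWaff, rfl, hqV,
    app_injective_of_stalkMap_injective G.π hπ.surjective hinj W, ?_⟩
  ext a
  have key : a ∈ {a : Γ(Y, G.π ⁻¹ᵁ W) |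
      expansion ι (G.π ⁻¹ᵁ W) hqV a ∈ completeLocalSubalgebra G.π G.w q ι} ↔
      Y.presheaf.germ (G.π ⁻¹ᵁ W) q hqV a ∈ Set.range (G.π.stalkMap q) := by
    rw [hr]
    exact Iff.rfl
  rw [key]
  constructor
  · rintro ⟨b, rfl⟩
    exact ⟨_, Scheme.Hom.germ_stalkMap_apply G.π W q hqV b⟩
  · intro ha
    refine mem_range_app_of_germ_mem_range G.π hπ hinj W a fun y hy ↦ ?_
    by_cases hyq : y = q
    · subst hyq
      exact ha
    · exact G.stalkMap_surjective hyq _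

end Existence

end CurveGluing

/-! ### The bijection and its inverse -/

theorem mainTheorem8 {Y : Scheme.{0}} (sY : Y ⟶ CurveGluing.SpecC)
    (hY : CurveGluing.IsCurve sY) (hYs : Smooth sY)
    (q : Y) (hq : IsClosed {q})
    (Γ : AddSubmonoid ℕ) (hΓ : ((Γ : Set ℕ)ᶜ).Finite) (hΓ' : Γ ≠ ⊤) :
    Nonempty (CurveGluing.CompleteLocalRing sY q ≃ₐ[ℂ] ℂ⟦X⟧) ∧
    ∀ ι : CurveGluing.CompleteLocalRing sY q ≃ₐ[ℂ] ℂ⟦X⟧,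
      ∃ Φ : CurveGluing.GluedCurves sY q Γ ≃ CurveGluing.CompleteSubalgebras Γ,
        (∀ G : CurveGluing.GluedCurve sY q Γ,
          Function.Injective
            (CurveGluing.completionMap (CurveGluing.localRingMap G.π G.w q)) ∧
          (Φ (Quotient.mk _ G)).1 = CurveGluing.completeLocalSubalgebra G.π G.w q ι) ∧
        (∀ (R : CurveGluing.CompleteSubalgebras Γ) (G : CurveGluing.GluedCurve sY q Γ),
          Φ.symm R = Quotient.mk _ G → G.IsGluingAlong ι R.1) := by
  refine ⟨CurveGluing.nonempty_completeLocalRing_algEquiv sY hY hq, fun ι ↦ ?_⟩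
  let Ψ : CurveGluing.GluedCurves sY q Γ → CurveGluing.CompleteSubalgebras Γ :=
    Quotient.lift (fun G ↦ G.toCompleteSubalgebra hY hq ι) fun G H h ↦
      Subtype.ext (CurveGluing.GluedCurve.completeLocalSubalgebra_eq_of_equiv hY hq ι h)
  have hΨ : Function.Bijective Ψ := by
    refine ⟨fun x y ↦ ?_, fun R ↦ ?_⟩
    · induction x, y using Quotient.inductionOn₂ with | _ G H
      intro h
      exact Quotient.sound (CurveGluing.GluedCurve.equiv_of_completeLocalSubalgebra_eq hY hq ι
        (congrArg Subtype.val h))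
    · obtain ⟨G, hG⟩ := CurveGluing.exists_gluedCurve hY hq hΓ hΓ' ι R
      exact ⟨Quotient.mk _ G, Subtype.ext hG⟩
  refine ⟨Equiv.ofBijective Ψ hΨ, fun G ↦ ⟨G.completionMap_injective hY hq, rfl⟩,
    fun R G h ↦ ?_⟩
  obtain rfl : R = G.toCompleteSubalgebra hY hq ι := (Equiv.symm_apply_eq _).mp h
  exact G.isGluingAlong hY hq ι
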